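/- **Proposition (kernel of the perturbed chiral GUE).** Let $N\ge 1$, let $\alpha>-1$ be real, and let $a_1,\dots,a_N\ge 0$. Put ${}_0F_1(c;z)=\sum_{k\ge0}\frac{z^k}{(c)_k\,k!}$ and $$w_\alpha(x,b)=\frac{x^{\alpha}e^{-x}}{\Gamma(\alpha+1)}\,{}_0F_1(\alpha+1;bx),\qquad w_\alpha(x)=w_\alpha(x,0),\qquad \eta_k(x)=(-1)^{k-1}(k-1)!\,L^{\alpha}_{k-1}(x),$$ where $L^\alpha_k$ is the associated Laguerre polynomial. Let $\xi_i(x)=w_\alpha(x,a_i)$ if the $a_i$ are pairwise distinct; in general let $\xi_i(x)=w_{\alpha+m_i}(x,a_i)$ with $m_i=\#\{j<i: a_j=a_i\}$, i.e. a parameter $b$ of multiplicity $m$ contributes $w_\alpha(x,b),\dots,w_{\alpha+m-1}(x,b)$. Then the integrals $g_{i,j}=\int_0^\infty\eta_i(x)\xi_j(x)\,dx$ converge absolutely, the matrix $\mathbf g=[g_{i,j}]$ is non-singular, and so the kernel of the perturbed chiral GUE $$K_N(x,y)=\sum_{i,j=1}^N\eta_i(x)\,c_{i,j}\,\xi_j(y),\qquad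 \mathbf c^{\mathrm t}=\mathbf g^{-1},$$ is defined. Let $x,y>0$. A contour is a closed piecewise $C^1$ curve in $\mathbb C$; it encircles a point (counterclockwise) if it avoids the point and has winding number $1$ about it. Let $\mathcal C^{\{u\}}_{-\mathbf a}$ be any contour, possibly depending on $u$, that encircles $-a_1,\dots,-a_N$, does not pass through $u$ and has winding number $0$ about $u$; let $\mathcal C_{\{0\}}$ and $\mathcal C'_{\{0\}}$ be any contours encircling $0$. 1. If all $a_i>0$, then $$K_N(x,y)=\frac{y^\alpha e^{-y+x}}{\Gamma(\alpha+1)^2}\int_0^\infty du\,u^\alpha e^{-u}\,{}_0F_1(\alpha+1;-xu)\int_{\mathcal C^{\{u\}}_{-\mathbf a}}\frac{dv}{2\pi i}\,\frac{e^v\,{}_0F_1(\alpha+1;-yv)}{u-v}\prod_{i=1}^N\frac{u+a_i}{v+a_i}.$$ 2. If all $a_i>0$ and moreover $\alpha$ is a non-negative integer and the contours $\mathcal C^{\{u\}}_{-\mathbf a}$ do not pass through $0$, then, as an iterated integral in the order written, $$\frac{w_\alpha(x)}{w_\alpha(y)}K_N(x,y)=\int_0^\infty du\int_{\mathcal C^{\{u\}}_{-\mathbf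 a}}\frac{dv}{2\pi i}\int_{\mathcal C_{\{0\}}}\frac{dw}{2\pi i}\int_{\mathcal C'_{\{0\}}}\frac{dz}{2\pi i}\,\frac{e^{v-u}}{u-v}\,\frac{e^{-u/w+v/z}}{zw}\,e^{xw-yz}\Big(\frac uv\Big)^{\alpha}\Big(\frac zw\Big)^{\alpha}\prod_{i=1}^N\frac{u+a_i}{v+a_i}.$$ 3. If some of the $a_i$ are $0$, both formulas remain valid, the second one again for integer $\alpha\ge0$ and contours avoiding $0$, when $\int_0^\infty du$ is read as $\lim_{\epsilon\to0^+}\int_\epsilon^\infty du$; the $v$-contours may here depend on $\epsilon$ as well as on $u$. All $u$-integrals converge absolutely, over $(0,\infty)$ in 1 and 2 and over $(\epsilon,\infty)$ in 3. -/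

import Mathlib

open Set Filter Topology MeasureTheory

noncomputable section

namespace PerturbedChGUE

/-- The confluent hypergeometric limit function
`₀F₁(c; z) = ∑ₖ zᵏ / ((c)ₖ k!)`, with `(c)ₖ` the rising Pochhammer symbol.
It is used over `ℝ` and over `ℂ`. -/
def hyp0F1 {𝕂 : Type*} [Field 𝕂] [TopologicalSpace 𝕂] (c z : 𝕂) : 𝕂 :=
  ∑' k : ℕ, z ^ k / ((ascPochhammer 𝕂 k).eval c * (k.factorial : 𝕂))

/-- The associated Laguerre polynomial (as a function of `x`)
`L_n^α(x) = ∑_{k=0}^n binom(n+α, n-k) (-x)ᵏ / k!`, for real `α > -1`, where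
`binom(n+α, n-k) = Γ(n+α+1) / (Γ(k+α+1) (n-k)!)`. -/
def laguerre (α : ℝ) (n : ℕ) (x : ℝ) : ℝ :=
  ∑ k ∈ Finset.range (n + 1),
    Real.Gamma (n + α + 1) / (Real.Gamma (k + α + 1) * ((n - k).factorial : ℝ)) *
      ((-x) ^ k / (k.factorial : ℝ))

/-! ### Biorthogonal ensembles -/

/-- The matrix `g i j = ∫_I η i (x) ξ j (x) dx`. -/
def gram {N : ℕ} (I : Set ℝ) (η ξ : Fin N → ℝ → ℝ) : Matrix (Fin N) (Fin N) ℝ :=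
  Matrix.of fun i j => ∫ x in I, η i x * ξ j x

/-- The correlation kernel `K(x, y) = ∑_{i,j} η i (x) c i j ξ j (y)` of the biorthogonal ensemble
with density proportional to `det [η i (x j)] det [ξ i (x j)]` on `I`; here
`∑ₖ g i k * c j k = δ i j`, that is `c = (g⁻¹)ᵀ`. -/
def biorthogonalKernel {N : ℕ} (I : Set ℝ) (η ξ : Fin N → ℝ → ℝ) (x y : ℝ) : ℝ :=
  ∑ i, ∑ j, η i x * ((gram I η ξ)⁻¹).transpose i j * ξ j y

/-! ### The perturbed chiral Gaussian unitary ensemble -/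

/-- `w_α(x, b) = x^α e^{-x} ₀F₁(α+1; b x) / Γ(α+1)`. -/
def weight (α b x : ℝ) : ℝ :=
  x ^ α * Real.exp (-x) * hyp0F1 (α + 1) (b * x) / Real.Gamma (α + 1)

/-- `η_k(x) = (-1)^(k-1) (k-1)! L_{k-1}^α(x)`, `k = 1, …, N` (indices are shifted by one). -/
def eta (α : ℝ) {N : ℕ} (i : Fin N) (x : ℝ) : ℝ :=
  (-1) ^ (i : ℕ) * ((i : ℕ).factorial : ℝ) * laguerre α i x

/-- The number of indices `j < i` with `a j = a i`. It is `0` for all `i` when the parameters are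
pairwise distinct. -/
def priorMultiplicity {N : ℕ} (a : Fin N → ℝ) (i : Fin N) : ℕ :=
  (Finset.univ.filter fun j => j < i ∧ a j = a i).card

/-- The functions `ξ_i`. For pairwise distinct parameters `ξ_i(x) = w_α(x, a_i)`. If some
parameters coincide, the ensemble is the one obtained in the limit: since
`∂w_α(x, b)/∂b = w_{α+1}(x, b)`, a parameter `b` of multiplicity `m` contributes the functions
`w_α(x, b), w_{α+1}(x, b), …, w_{α+m-1}(x, b)`. -/
def xi (α : ℝ) {N : ℕ} (a : Fin N → ℝ) (i : Fin N) (x : ℝ) : ℝ :=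
  weight (α + priorMultiplicity a i) (a i) x

/-- For pairwise distinct parameters `ξ_i(x) = w_α(x, a_i)`. -/
theorem xi_of_injective (α : ℝ) {N : ℕ} (a : Fin N → ℝ) (ha : Function.Injective a) (i : Fin N)
    (x : ℝ) : xi α a i x = weight α (a i) x := by
  have h : priorMultiplicity a i = 0 := by
    rw [priorMultiplicity, Finset.card_eq_zero, Finset.filter_eq_empty_iff]
    rintro j - ⟨hj, hij⟩
    exact hj.ne (ha hij)
  simp [xi, h]

/-- The kernel `K_N(x, y)` of the perturbed chiral Gaussian unitary ensemble on `(0, ∞)`. -/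
def kernel (α : ℝ) {N : ℕ} (a : Fin N → ℝ) (x y : ℝ) : ℝ :=
  biorthogonalKernel (Ioi 0) (eta α) (xi α a) x y

/-! ### Contours -/

/-- A closed piecewise `C¹` curve in the complex plane, parametrized by `[0, 1]`. -/
structure Contour where
  /-- The parametrization; only its values on `[0, 1]` matter. -/
  toFun : ℝ → ℂ
  continuousOn : ContinuousOn toFun (Icc 0 1)
  closed : toFun 0 = toFun 1
  piecewise : ∃ (n : ℕ) (p : ℕ → ℝ), Monotone p ∧ p 0 = 0 ∧ p n = 1 ∧
    ∀ k < n, ContDiffOn ℝ 1 toFun (Icc (p k) (p (k + 1)))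

namespace Contour

/-- The image of the curve. -/
def support (C : Contour) : Set ℂ := C.toFun '' Icc 0 1

/-- The normalized contour integral `∫_C f(z) dz / (2πi)`. -/
def integral (C : Contour) (f : ℂ → ℂ) : ℂ :=
  (2 * Real.pi * Complex.I)⁻¹ * ∫ t in (0 : ℝ)..1, f (C.toFun t) * deriv C.toFun t

/-- The winding number of `C` about a point `p` (not on `C`). -/
def index (C : Contour) (p : ℂ) : ℂ := C.integral fun z => (z - p)⁻¹

/-- `C` encircles `p` once, counterclockwise. -/
def Encircles (C : Contour) (p : ℂ) : Prop := p ∉ C.support ∧ C.index p = 1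

/-- `C` neither meets nor encircles `p`. -/
def Excludes (C : Contour) (p : ℂ) : Prop := p ∉ C.support ∧ C.index p = 0

/-- `C` encircles the points `-a_1, …, -a_N` counterclockwise, but not the point `u`. -/
def Separates (C : Contour) {N : ℕ} (a : Fin N → ℝ) (u : ℝ) : Prop :=
  (∀ i, C.Encircles (-(a i : ℂ))) ∧ C.Excludes (u : ℂ)

end Contour

/-! ### The integrands with respect to `u` -/

/-- `u^α e^{-u} ₀F₁(α+1; -xu) ∫_C dv/(2πi) e^v ₀F₁(α+1; -yv) / (u-v) ∏ᵢ (u+aᵢ)/(v+aᵢ)`. -/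
def doubleIntegrand (α : ℝ) {N : ℕ} (a : Fin N → ℝ) (x y : ℝ) (C : Contour) (u : ℝ) : ℂ :=
  ((u ^ α * Real.exp (-u) * hyp0F1 (α + 1) (-(x * u)) : ℝ) : ℂ) *
    C.integral fun v =>
      Complex.exp v * hyp0F1 ((α : ℂ) + 1) (-(y * v)) / (u - v) * ∏ i, (u + a i) / (v + a i)

/-- `∫_C dv/(2πi) ∫_{C_w} dw/(2πi) ∫_{C_z} dz/(2πi)` of
`e^{v-u}/(u-v) e^{-u/w+v/z}/(zw) e^{xw-yz} (u/v)^m (z/w)^m ∏ᵢ (u+aᵢ)/(v+aᵢ)`. -/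
def quadrupleIntegrand (m : ℕ) {N : ℕ} (a : Fin N → ℝ) (x y : ℝ) (Cw Cz C : Contour) (u : ℝ) :
    ℂ :=
  C.integral fun v => Cw.integral fun w => Cz.integral fun z =>
    Complex.exp (v - u) / (u - v) * (Complex.exp (-u / w + v / z) / (z * w)) *
      Complex.exp (x * w - y * z) * ((u / v) ^ m * (z / w) ^ m) * ∏ i, (u + a i) / (v + a i)

end PerturbedChGUE

end

open PerturbedChGUE

noncomputable section

namespace PerturbedChGUE.Contour

/-! ### Contour integrals -/

/-! Count `i` from 0. Three facts carry the proof.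

The pairings are explicit. By Gamma integrals, `∫ x^l w_β(x,b) dx = ∑ₙ (β+1+n)_l bⁿ/n!`. The
Laguerre coefficients convert rising factorials into falling ones and back, so `∫ η_i w_α(·,b) = bⁱ
eᵇ`, and conversely `∫ (-u)ⁱ w_α(u,-x) du = e^{-x} η_i(x)`. Replacing `α` by `α+m` in the weight
amounts to `m` derivatives in `b`. Hence `g` is a confluent Vandermonde matrix with exponential
factors, and it is non-singular because a nonzero polynomial of degree less than `N` cannot vanish
at `N` nodes counted with multiplicity (`isUnit_det_gram`).

The kernel is an interpolation. Write `K_N(x,y) = ∑ κ_i(y) η_i(x)`. Inverting `g` says that `∑ κ_i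
bⁱ eᵇ` agrees with `w_α(y,b)` at the `a_j`, in the Hermite sense; so `p(v) = ∑ κ_i (-v)ⁱ` is the
Hermite interpolant of `eᵛ w_α(y,-v)` at the `-a_j`. The `v`-integral is the contour formula for
that interpolant and equals `p(u)` up to a constant (`cauchyFunctional_eq_of_sub_eq`). Integrating
`p(u)` against `w_α(u,-x)` turns each `(-u)ⁱ` into `e^{-x} η_i(x)`, which gives the double integral.

The `w`- and `z`-integrals are Bessel-type representations of `₀F₁`, obtained by expanding both
exponentials and keeping the power `-1`.

The `u`-integrand thus equals one integrable function whatever contours are chosen. No measurability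
in `u` is needed, and the limit `ε → 0⁺` is dominated convergence. Contours are known only through
winding numbers, so primitives and partial fractions replace the residue theorem. -/

theorem mem_support (C : Contour) {t : ℝ} (ht : t ∈ Icc (0 : ℝ) 1) : C.toFun t ∈ C.support :=
  mem_image_of_mem _ ht

theorem isCompact_support (C : Contour) : IsCompact C.support :=
  isCompact_Icc.image_of_continuousOn C.continuousOn

/-- Away from the partition points, `t` lies strictly inside one `C¹` piece, the one ending at the
first `p k ≥ t`. -/
theorem exists_countable_differentiableAt (C : Contour) :
    ∃ s : Set ℝ, s.Countable ∧ ∀ t ∈ Ioo (0 : ℝ) 1 \ s, DifferentiableAt ℝ C.toFun t := by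
  obtain ⟨n, p, hp, h0, h1, hC⟩ := C.piecewise
  refine ⟨range p, countable_range p, ?_⟩
  rintro t ⟨⟨ht0, ht1⟩, hts⟩
  have hex : ∃ k, t ≤ p k := ⟨n, by rw [h1]; exact ht1.le⟩
  classical
  set k := Nat.find hex with hk
  have hkp : t ≤ p k := Nat.find_spec hex
  have hk0 : k ≠ 0 := by
    intro h
    rw [h, h0] at hkp
    linarith
  obtain ⟨l, hl⟩ := Nat.exists_eq_succ_of_ne_zero hk0
  have hlt : p l < t := not_le.1 (Nat.find_min hex (m := l) (by omega))
  have hkn : k ≤ n := Nat.find_min' hex (by rw [h1]; exact ht1.le)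
  have htk : t < p (l + 1) := by
    rw [hl] at hkp
    exact lt_of_le_of_ne hkp fun h => hts ⟨l + 1, h.symm⟩
  exact ((hC l (by omega)).differentiableOn one_ne_zero).differentiableAt (Icc_mem_nhds hlt htk)

/-- On each open piece `deriv` agrees with `derivWithin`, which is continuous up to the ends of the
closed piece; the partition points are null. -/
theorem intervalIntegrable_deriv (C : Contour) :
    IntervalIntegrable (deriv C.toFun) volume 0 1 := by
  obtain ⟨n, p, hp, h0, h1, hC⟩ := C.piecewise
  rw [← h0, ← h1]
  refine IntervalIntegrable.trans_iterate fun k hk => ?_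
  rcases (hp (Nat.le_succ k)).eq_or_lt with h | h
  · rw [h]
  · have hc : ContinuousOn (derivWithin C.toFun (Icc (p k) (p (k + 1)))) (Icc (p k) (p (k + 1))) :=
      (hC k hk).continuousOn_derivWithin (uniqueDiffOn_Icc h) le_rfl
    have hi := hc.intervalIntegrable_of_Icc (μ := volume) h.le
    rw [intervalIntegrable_iff_integrableOn_Ioo_of_le h.le] at hi ⊢
    refine hi.congr_fun (fun t ht => ?_) measurableSet_Ioo
    exact derivWithin_of_mem_nhds (Icc_mem_nhds ht.1 ht.2)

theorem continuousOn_comp (C : Contour) {f : ℂ → ℂ} (hf : ContinuousOn f C.support) :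
    ContinuousOn (fun t => f (C.toFun t)) (Icc 0 1) :=
  hf.comp C.continuousOn fun _ ht => C.mem_support ht

theorem intervalIntegrable (C : Contour) {f : ℂ → ℂ} (hf : ContinuousOn f C.support) :
    IntervalIntegrable (fun t => f (C.toFun t) * deriv C.toFun t) volume 0 1 := by
  refine C.intervalIntegrable_deriv.continuousOn_mul ?_
  rw [uIcc_of_le zero_le_one]
  exact C.continuousOn_comp hf

theorem integral_congr (C : Contour) {f g : ℂ → ℂ} (h : ∀ z ∈ C.support, f z = g z) :
    C.integral f = C.integral g := by
  unfold integral
  congr 1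
  refine intervalIntegral.integral_congr fun t ht => ?_
  rw [uIcc_of_le zero_le_one] at ht
  simp only [h _ (C.mem_support ht)]

theorem integral_const_mul (C : Contour) (c : ℂ) (f : ℂ → ℂ) :
    (C.integral fun z => c * f z) = c * C.integral f := by
  unfold integral
  simp only [mul_assoc, intervalIntegral.integral_const_mul]
  ring

theorem integral_zero (C : Contour) : (C.integral fun _ => 0) = 0 := by
  simp [integral]

theorem integral_add (C : Contour) {f g : ℂ → ℂ} (hf : ContinuousOn f C.support)
    (hg : ContinuousOn g C.support) :
    (C.integral fun z => f z + g z) = C.integral f + C.integral g := by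
  unfold integral
  simp only [add_mul]
  rw [intervalIntegral.integral_add (C.intervalIntegrable hf) (C.intervalIntegrable hg), mul_add]

theorem integral_sub (C : Contour) {f g : ℂ → ℂ} (hf : ContinuousOn f C.support)
    (hg : ContinuousOn g C.support) :
    (C.integral fun z => f z - g z) = C.integral f - C.integral g := by
  unfold integral
  simp only [sub_mul]
  rw [intervalIntegral.integral_sub (C.intervalIntegrable hf) (C.intervalIntegrable hg), mul_sub]

/-- The integral of a derivative along a closed curve vanishes. -/
theorem integral_eq_zero_of_hasDerivAt (C : Contour) {F f : ℂ → ℂ}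
    (hf : ContinuousOn f C.support) (hF : ∀ z ∈ C.support, HasDerivAt F (f z) z) :
    C.integral f = 0 := by
  obtain ⟨s, hs, hd⟩ := C.exists_countable_differentiableAt
  have hFc : ContinuousOn F C.support := fun z hz => (hF z hz).continuousAt.continuousWithinAt
  have := integral_eq_of_hasDerivAt_off_countable_of_le (fun t => F (C.toFun t))
    (fun t => f (C.toFun t) * deriv C.toFun t) zero_le_one hs (C.continuousOn_comp hFc)
    (fun t ht => ?_) (C.intervalIntegrable hf)
  · simp [integral, this, C.closed]
  · exact (hF _ (C.mem_support (Ioo_subset_Icc_self ht.1))).comp_of_eq t (hd t ht).hasDerivAt rfl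

theorem integral_eq_zero_of_differentiable (C : Contour) {f : ℂ → ℂ} (hf : Differentiable ℂ f) :
    C.integral f = 0 := by
  obtain ⟨F, hF⟩ := hf.isExactOn_univ
  exact C.integral_eq_zero_of_hasDerivAt hf.continuous.continuousOn fun z _ => hF z (mem_univ z)

theorem hasSum_integral (C : Contour) {ι : Type*} [Countable ι] {f : ι → ℂ → ℂ} {g : ℂ → ℂ}
    {b : ι → ℝ} (hf : ∀ n, ContinuousOn (f n) C.support) (hb : Summable b)
    (hfb : ∀ n, ∀ z ∈ C.support, ‖f n z‖ ≤ b n) (hg : ∀ z ∈ C.support, HasSum (f · z) (g z)) :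
    HasSum (fun n => C.integral (f n)) (C.integral g) := by
  unfold integral
  refine HasSum.mul_left _ ?_
  have hmem : ∀ t ∈ uIoc (0 : ℝ) 1, C.toFun t ∈ C.support := fun t ht => by
    rw [uIoc_of_le zero_le_one] at ht
    exact C.mem_support (Ioc_subset_Icc_self ht)
  refine intervalIntegral.hasSum_integral_of_dominated_convergence
    (fun n t => b n * ‖deriv C.toFun t‖) (fun n => ?_) (fun n => ?_) ?_ ?_ ?_
  · exact (C.intervalIntegrable (hf n)).aestronglyMeasurable_restrict_uIoc
  · refine ae_of_all _ fun t ht => ?_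
    rw [norm_mul]
    exact mul_le_mul_of_nonneg_right (hfb n _ (hmem t ht)) (norm_nonneg _)
  · exact ae_of_all _ fun t _ => hb.mul_right _
  · simp only [tsum_mul_right]
    exact C.intervalIntegrable_deriv.norm.const_mul _
  · exact ae_of_all _ fun t ht => (hg _ (hmem t ht)).mul_right _

theorem sub_ne_zero_of_notMem (C : Contour) {p z : ℂ} (hp : p ∉ C.support) (hz : z ∈ C.support) :
    z - p ≠ 0 :=
  sub_ne_zero.2 fun h => hp (h ▸ hz)

/-- Integral powers other than `-1` integrate to zero. -/
theorem integral_zpow_sub (C : Contour) {p : ℂ} (hp : p ∉ C.support) {k : ℤ} (hk : k ≠ -1) :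
    (C.integral fun z => (z - p) ^ k) = 0 := by
  have hk' : ((k : ℂ) + 1) ≠ 0 := by
    exact_mod_cast fun h => hk (by omega)
  have hne : ∀ z ∈ C.support, z - p ≠ 0 := fun z hz => C.sub_ne_zero_of_notMem hp hz
  refine C.integral_eq_zero_of_hasDerivAt (F := fun z => ((k : ℂ) + 1)⁻¹ * (z - p) ^ (k + 1)) ?_ ?_
  · exact (continuous_id.sub continuous_const).continuousOn.zpow₀ k fun z hz => Or.inl (hne z hz)
  · intro z hz
    have h := ((hasDerivAt_zpow (k + 1) (z - p) (Or.inl (hne z hz))).comp z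
      ((hasDerivAt_id z).sub_const p)).const_mul (((k : ℂ) + 1)⁻¹)
    refine h.congr_deriv ?_
    push_cast
    rw [add_sub_cancel_right, mul_one, inv_mul_cancel_left₀ hk']

theorem integral_zpow (C : Contour) (hC : C.Encircles 0) (k : ℤ) :
    (C.integral fun z => z ^ k) = if k = -1 then 1 else 0 := by
  split_ifs with h
  · subst h
    simpa [index] using hC.2
  · simpa using C.integral_zpow_sub hC.1 h

/-! ### The Cauchy-type functional of Hermite interpolation -/

section Residues

variable {ι : Type*}

theorem add_ne_zero_of_encircles (C : Contour) {c v : ℂ} (hc : C.Encircles (-c))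
    (hv : v ∈ C.support) : v + c ≠ 0 := by
  simpa using C.sub_ne_zero_of_notMem hc.1 hv

theorem continuousOn_inv_prod (C : Contour) {s : Finset ι} {a : ι → ℂ}
    (h : ∀ i ∈ s, C.Encircles (-(a i))) :
    ContinuousOn (fun v => (∏ i ∈ s, (v + a i))⁻¹) C.support :=
  (continuous_finsetProd s fun _ _ => continuous_id.add continuous_const).continuousOn.inv₀
    fun _ hv => Finset.prod_ne_zero_iff.2 fun i hi => C.add_ne_zero_of_encircles (h i hi) hv

/-- The integral of `∏ (v + aᵢ)⁻¹` around all its poles. -/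
theorem integral_inv_prod (C : Contour) (a : ι → ℂ) (s : Finset ι) (hs : s.Nonempty)
    (h : ∀ i ∈ s, C.Encircles (-(a i))) :
    (C.integral fun v => (∏ i ∈ s, (v + a i))⁻¹) = if s.card = 1 then 1 else 0 := by
  classical
  induction hn : s.card using Nat.strong_induction_on generalizing s with
  | _ n ih =>
  subst hn
  by_cases h1 : s.card = 1
  · obtain ⟨i, rfl⟩ := Finset.card_eq_one.1 h1
    simpa [index] using (h i (by simp)).2
  rw [if_neg h1]
  have h2 : 2 ≤ s.card := by
    have := hs.card_pos
    omega
  -- With two distinct nodes, partial fractions give a difference of two products with one node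
  -- fewer. Both have the same number of factors, hence the same integral. If all nodes coincide,
  -- the integrand is a power with exponent at most `-2`.
  by_cases hex : ∃ i ∈ s, ∃ j ∈ s, a i ≠ a j
  · obtain ⟨i, hi, j, hj, hij⟩ := hex
    have hci := Finset.card_erase_of_mem hi
    have hcj := Finset.card_erase_of_mem hj
    have hei : ∀ k ∈ s.erase i, C.Encircles (-(a k)) := fun k hk => h k (Finset.mem_of_mem_erase hk)
    have hej : ∀ k ∈ s.erase j, C.Encircles (-(a k)) := fun k hk => h k (Finset.mem_of_mem_erase hk)
    have hIi := ih _ (by omega) (s.erase i) (Finset.card_pos.1 (by omega)) hei rfl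
    have hIj := ih _ (by omega) (s.erase j) (Finset.card_pos.1 (by omega)) hej rfl
    have key : ∀ v ∈ C.support, (∏ k ∈ s, (v + a k))⁻¹ =
        (a j - a i)⁻¹ * ((∏ k ∈ s.erase j, (v + a k))⁻¹ - (∏ k ∈ s.erase i, (v + a k))⁻¹) := by
      intro v hv
      have hne : ∀ k ∈ s, v + a k ≠ 0 := fun k hk => C.add_ne_zero_of_encircles (h k hk) hv
      have e1 := Finset.mul_prod_erase s (fun k => v + a k) hi
      have e2 := Finset.mul_prod_erase s (fun k => v + a k) hj
      have hp : ∏ k ∈ s, (v + a k) ≠ 0 := Finset.prod_ne_zero_iff.2 hne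
      have e3 : (∏ k ∈ s.erase i, (v + a k))⁻¹ = (v + a i) * (∏ k ∈ s, (v + a k))⁻¹ := by
        rw [← e1, mul_inv, mul_inv_cancel_left₀ (hne i hi)]
      have e4 : (∏ k ∈ s.erase j, (v + a k))⁻¹ = (v + a j) * (∏ k ∈ s, (v + a k))⁻¹ := by
        rw [← e2, mul_inv, mul_inv_cancel_left₀ (hne j hj)]
      rw [e3, e4, ← sub_mul, add_sub_add_left_eq_sub,
        inv_mul_cancel_left₀ (sub_ne_zero.2 hij.symm)]
    rw [C.integral_congr key, integral_const_mul,
      C.integral_sub (C.continuousOn_inv_prod hej) (C.continuousOn_inv_prod hei), hIi, hIj, hci, hcj,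
      sub_self, mul_zero]
  · push Not at hex
    obtain ⟨i, hi⟩ := hs
    have hz := C.integral_zpow_sub (h i hi).1 (k := -(s.card : ℤ)) (by omega)
    rw [← hz]
    refine C.integral_congr fun v _ => ?_
    rw [Finset.prod_congr rfl fun k hk => by rw [hex k hk i hi], Finset.prod_const, zpow_neg,
      zpow_natCast, sub_neg_eq_add]

open Polynomial in
-- Division by `v + a i` lowers the degree and the number of poles together, so the gap of two
-- persists; the constant remainder sits over at least two poles and integrates to zero.
theorem integral_polynomial_mul_inv_prod (C : Contour) (a : ι → ℂ) (s : Finset ι)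
    (h : ∀ i ∈ s, C.Encircles (-(a i))) (p : ℂ[X]) (hp : p.natDegree + 2 ≤ s.card) :
    (C.integral fun v => p.eval v * (∏ i ∈ s, (v + a i))⁻¹) = 0 := by
  classical
  induction hd : p.natDegree generalizing p s with
  | zero =>
    obtain ⟨c, rfl⟩ := natDegree_eq_zero.1 hd
    simp only [eval_C]
    rw [integral_const_mul, C.integral_inv_prod a s (Finset.card_pos.1 (by omega)) h,
      if_neg (by omega), mul_zero]
  | succ d ih =>
    have hs : s.Nonempty := Finset.card_pos.1 (by omega)
    obtain ⟨i, hi⟩ := id hs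
    have hdiv := modByMonic_add_div p (X - Polynomial.C (-(a i)))
    rw [modByMonic_X_sub_C_eq_C_eval] at hdiv
    set q := p /ₘ (X - Polynomial.C (-(a i)))
    have hq : q.natDegree = d := by
      rw [natDegree_divByMonic _ (monic_X_sub_C _), natDegree_X_sub_C]
      omega
    have he : ∀ k ∈ s.erase i, C.Encircles (-(a k)) := fun k hk => h k (Finset.mem_of_mem_erase hk)
    have hci := Finset.card_erase_of_mem hi
    have key : ∀ v ∈ C.support, p.eval v * (∏ k ∈ s, (v + a k))⁻¹ =
        p.eval (-(a i)) * (∏ k ∈ s, (v + a k))⁻¹ +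
          q.eval v * (∏ k ∈ s.erase i, (v + a k))⁻¹ := by
      intro v hv
      have hne := C.add_ne_zero_of_encircles (h i hi) hv
      have e3 : (∏ k ∈ s.erase i, (v + a k))⁻¹ = (v + a i) * (∏ k ∈ s, (v + a k))⁻¹ := by
        rw [← Finset.mul_prod_erase s (fun k => v + a k) hi, mul_inv, mul_inv_cancel_left₀ hne]
      have hpe : p.eval v = p.eval (-(a i)) + (v + a i) * q.eval v := by
        conv_lhs => rw [← hdiv]
        simp
      rw [e3, hpe]
      ring
    rw [C.integral_congr key, C.integral_add, integral_const_mul,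
      C.integral_inv_prod a s hs h, if_neg (by omega), mul_zero, zero_add]
    · exact ih (s.erase i) he q (by omega) hq
    · exact continuousOn_const.mul (C.continuousOn_inv_prod h)
    · exact q.continuous.continuousOn.mul (C.continuousOn_inv_prod he)

theorem sub_ne_zero_of_excludes (C : Contour) {u v : ℂ} (hu : C.Excludes u) (hv : v ∈ C.support) :
    u - v ≠ 0 :=
  sub_ne_zero.2 fun h => hu.1 (h ▸ hv)

theorem continuousOn_inv_const_sub (C : Contour) {u : ℂ} (hu : C.Excludes u) :
    ContinuousOn (fun v => (u - v)⁻¹) C.support :=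
  (continuous_const.sub continuous_id).continuousOn.inv₀ fun _ hv => C.sub_ne_zero_of_excludes hu hv

theorem integral_inv_const_sub (C : Contour) {u : ℂ} (hu : C.Excludes u) :
    (C.integral fun v => (u - v)⁻¹) = 0 := by
  have h : ∀ v ∈ C.support, (u - v)⁻¹ = -1 * (v - u)⁻¹ := fun v _ => by
    rw [← neg_sub v u, inv_neg, neg_one_mul]
  rw [C.integral_congr h, integral_const_mul]
  simpa [index] using hu.2

/-- The functional `f ↦ ∮ f(v) / (u - v) ∏ (u + aᵢ) / (v + aᵢ) dv / (2πi)`. -/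
noncomputable def cauchyFunctional (C : Contour) (s : Finset ι) (a : ι → ℂ) (u : ℂ) (f : ℂ → ℂ) :
    ℂ :=
  C.integral fun v => f v / (u - v) * ∏ i ∈ s, (u + a i) / (v + a i)

theorem continuousOn_cauchyKernel (C : Contour) {s : Finset ι} {a : ι → ℂ} {u : ℂ}
    (h : ∀ i ∈ s, C.Encircles (-(a i))) (hu : C.Excludes u) {f : ℂ → ℂ} (hf : Continuous f) :
    ContinuousOn (fun v => f v / (u - v) * ∏ i ∈ s, (u + a i) / (v + a i)) C.support := by
  have e : ∀ v, ∏ i ∈ s, (u + a i) / (v + a i) =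
      (∏ i ∈ s, (u + a i)) * (∏ i ∈ s, (v + a i))⁻¹ := fun v => by
    rw [Finset.prod_div_distrib, div_eq_mul_inv]
  simp only [e, div_eq_mul_inv (f _)]
  exact (hf.continuousOn.mul (C.continuousOn_inv_const_sub hu)).mul
    (continuousOn_const.mul (C.continuousOn_inv_prod h))

/-- Since `(u + a)/(v + a) = 1 + (u - v)/(v + a)`, a new node adds a term free of `u - v`. Its
integral is `1` for the first node and `0` for every later one. -/
theorem cauchyFunctional_one (C : Contour) (s : Finset ι) (a : ι → ℂ) (u : ℂ)
    (h : ∀ i ∈ s, C.Encircles (-(a i))) (hu : C.Excludes u) :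
    C.cauchyFunctional s a u (fun _ => 1) = if s.Nonempty then 1 else 0 := by
  classical
  induction s using Finset.induction_on with
  | empty => simpa [cauchyFunctional] using C.integral_inv_const_sub hu
  | insert k s hk ih =>
    have hs : ∀ i ∈ s, C.Encircles (-(a i)) := fun i hi => h i (Finset.mem_insert_of_mem hi)
    have key : ∀ v ∈ C.support, 1 / (u - v) * ∏ i ∈ insert k s, (u + a i) / (v + a i) =
        1 / (u - v) * ∏ i ∈ s, (u + a i) / (v + a i) +
          (∏ i ∈ s, (u + a i)) * (∏ i ∈ insert k s, (v + a i))⁻¹ := by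
      intro v hv
      have h1 := C.sub_ne_zero_of_excludes hu hv
      have h2 := C.add_ne_zero_of_encircles (h k (Finset.mem_insert_self k s)) hv
      have h3 : ∏ i ∈ s, (v + a i) ≠ 0 :=
        Finset.prod_ne_zero_iff.2 fun i hi => C.add_ne_zero_of_encircles (hs i hi) hv
      rw [Finset.prod_insert hk, Finset.prod_insert hk, Finset.prod_div_distrib]
      field_simp
      ring
    rw [cauchyFunctional, C.integral_congr key, C.integral_add, integral_const_mul,
      C.integral_inv_prod a _ (Finset.insert_nonempty k s) h, Finset.card_insert_of_notMem hk]
    · rw [cauchyFunctional] at ih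
      rw [ih hs, if_pos (Finset.insert_nonempty k s)]
      rcases s.eq_empty_or_nonempty with rfl | hne
      · simp
      · simp [hne, hne.card_ne_zero]
    · exact C.continuousOn_cauchyKernel hs hu (f := fun _ => 1) continuous_const
    · exact continuousOn_const.mul (C.continuousOn_inv_prod h)

open Polynomial in
/-- On polynomials of degree less than the number of nodes the functional is evaluation at `u`. -/
theorem cauchyFunctional_polynomial (C : Contour) (s : Finset ι) (a : ι → ℂ) (u : ℂ)
    (h : ∀ i ∈ s, C.Encircles (-(a i))) (hu : C.Excludes u) (p : ℂ[X]) (hp : p.degree < s.card) :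
    C.cauchyFunctional s a u (fun v => p.eval v) = p.eval u := by
  rcases eq_or_ne p 0 with rfl | hp0
  · simp [cauchyFunctional, integral_zero]
  have hpn : p.natDegree < s.card := (natDegree_lt_iff_degree_lt hp0).2 hp
  have hs : s.Nonempty := Finset.card_pos.1 (by omega)
  have hdiv := modByMonic_add_div p (X - Polynomial.C u)
  rw [modByMonic_X_sub_C_eq_C_eval] at hdiv
  set q := p /ₘ (X - Polynomial.C u)
  -- Split `p(v) = p(u) + (v - u) q(v)`: the second term cancels the Cauchy kernel.
  have key : ∀ v ∈ C.support, p.eval v / (u - v) * ∏ i ∈ s, (u + a i) / (v + a i) =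
      p.eval u * (1 / (u - v) * ∏ i ∈ s, (u + a i) / (v + a i)) +
        (-∏ i ∈ s, (u + a i)) * (q.eval v * (∏ i ∈ s, (v + a i))⁻¹) := by
    intro v hv
    have h1 := C.sub_ne_zero_of_excludes hu hv
    have hpe : p.eval v = p.eval u + (v - u) * q.eval v := by
      conv_lhs => rw [← hdiv]
      simp
    rw [hpe, Finset.prod_div_distrib]
    field_simp
    ring
  have hq : (C.integral fun v => q.eval v * (∏ i ∈ s, (v + a i))⁻¹) = 0 := by
    have hqd : q.natDegree = p.natDegree - 1 := by
      rw [natDegree_divByMonic _ (monic_X_sub_C _), natDegree_X_sub_C]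
    -- A constant `p` is separate: there may be only one node, and the degree bound for `q` would
    -- fail, but `q` is then zero.
    rcases Nat.eq_zero_or_pos p.natDegree with h0 | h0
    · have : q = 0 := by
        refine (divByMonic_eq_zero_iff (monic_X_sub_C u)).2 ?_
        rw [degree_X_sub_C, degree_eq_natDegree hp0, h0]
        simp
      simp [this, integral_zero]
    · exact C.integral_polynomial_mul_inv_prod a s h q (by omega)
  rw [cauchyFunctional, C.integral_congr key, C.integral_add, integral_const_mul,
    integral_const_mul, hq]
  · have := C.cauchyFunctional_one s a u h hu
    rw [cauchyFunctional] at this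
    rw [this, if_pos hs, mul_one, mul_zero, add_zero]
  · exact continuousOn_const.mul
      (C.continuousOn_cauchyKernel h hu (f := fun _ => 1) continuous_const)
  · exact continuousOn_const.mul (q.continuous.continuousOn.mul (C.continuousOn_inv_prod h))

/-- The difference quotient of `q` at `u` is entire, so only `q u` times the winding number about
`u` could remain, and that number is zero. -/
theorem integral_div_const_sub (C : Contour) {u : ℂ} (hu : C.Excludes u) {q : ℂ → ℂ}
    (hq : Differentiable ℂ q) : (C.integral fun v => q v / (u - v)) = 0 := by
  have hd : Differentiable ℂ (dslope q u) := by
    rw [← differentiableOn_univ, Complex.differentiableOn_dslope univ_mem]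
    exact hq.differentiableOn
  have key : ∀ v ∈ C.support, q v / (u - v) = q u * (u - v)⁻¹ - dslope q u v := by
    intro v hv
    have h1 := C.sub_ne_zero_of_excludes hu hv
    have h2 := sub_smul_dslope q u v
    rw [smul_eq_mul] at h2
    field_simp
    linear_combination (-1 : ℂ) * h2
  rw [C.integral_congr key, C.integral_sub, integral_const_mul, C.integral_inv_const_sub hu,
    C.integral_eq_zero_of_differentiable hd, mul_zero, sub_zero]
  · exact continuousOn_const.mul (C.continuousOn_inv_const_sub hu)
  · exact hd.continuous.continuousOn

/-- The functional annihilates the entire functions vanishing at all nodes. -/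
theorem cauchyFunctional_prod_mul (C : Contour) (s : Finset ι) (a : ι → ℂ) (u : ℂ)
    (h : ∀ i ∈ s, C.Encircles (-(a i))) (hu : C.Excludes u) {q : ℂ → ℂ} (hq : Differentiable ℂ q) :
    C.cauchyFunctional s a u (fun v => (∏ i ∈ s, (v + a i)) * q v) = 0 := by
  have key : ∀ v ∈ C.support,
      (∏ i ∈ s, (v + a i)) * q v / (u - v) * ∏ i ∈ s, (u + a i) / (v + a i) =
        (∏ i ∈ s, (u + a i)) * (q v / (u - v)) := by
    intro v hv
    have h1 := C.sub_ne_zero_of_excludes hu hv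
    have h3 : ∏ i ∈ s, (v + a i) ≠ 0 :=
      Finset.prod_ne_zero_iff.2 fun i hi => C.add_ne_zero_of_encircles (h i hi) hv
    rw [Finset.prod_div_distrib]
    field_simp
  rw [cauchyFunctional, C.integral_congr key, integral_const_mul, C.integral_div_const_sub hu hq,
    mul_zero]

/-- Hermite's formula: by linearity the functional reproduces the interpolant `p` and kills the
multiple of the node polynomial. -/
theorem cauchyFunctional_eq_of_sub_eq (C : Contour) (s : Finset ι) (a : ι → ℂ) (u : ℂ)
    (h : ∀ i ∈ s, C.Encircles (-(a i))) (hu : C.Excludes u) {f q : ℂ → ℂ}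
    (hq : Differentiable ℂ q) (p : Polynomial ℂ) (hp : p.degree < s.card)
    (hf : ∀ v, f v = p.eval v + (∏ i ∈ s, (v + a i)) * q v) :
    C.cauchyFunctional s a u f = p.eval u := by
  have key : ∀ v ∈ C.support, f v / (u - v) * ∏ i ∈ s, (u + a i) / (v + a i) =
      p.eval v / (u - v) * ∏ i ∈ s, (u + a i) / (v + a i) +
        (∏ i ∈ s, (v + a i)) * q v / (u - v) * ∏ i ∈ s, (u + a i) / (v + a i) := fun v _ => by
    rw [hf, add_div, add_mul]
  rw [cauchyFunctional, C.integral_congr key, C.integral_add]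
  · have h1 := C.cauchyFunctional_polynomial s a u h hu p hp
    have h2 := C.cauchyFunctional_prod_mul s a u h hu hq
    rw [cauchyFunctional] at h1 h2
    rw [h1, h2, add_zero]
  · exact C.continuousOn_cauchyKernel h hu p.continuous
  · exact C.continuousOn_cauchyKernel h hu
      (f := fun v => (∏ i ∈ s, (v + a i)) * q v) ((continuous_finsetProd s fun i _ =>
      continuous_id.add continuous_const).mul hq.continuous)

end Residues

end PerturbedChGUE.Contour

namespace PerturbedChGUE

/-! ### Exponential generating functions of geometrically bounded sequences -/

/-- The sequence grows at most geometrically. -/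
def GeomBounded (A : ℕ → ℂ) : Prop :=
  ∃ C R : ℝ, 0 ≤ C ∧ 0 ≤ R ∧ ∀ n, ‖A n‖ ≤ C * R ^ n

/-- The exponential generating function `∑ Aₙ bⁿ / n!`. -/
def expSeries (A : ℕ → ℂ) (b : ℂ) : ℂ := ∑' n : ℕ, A n * b ^ n / (n.factorial : ℂ)

namespace GeomBounded

variable {A B : ℕ → ℂ}

theorem mul (hA : GeomBounded A) (hB : GeomBounded B) : GeomBounded fun n => A n * B n := by
  obtain ⟨C, R, hC, hR, h⟩ := hA
  obtain ⟨D, S, hD, hS, h'⟩ := hB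
  refine ⟨C * D, R * S, by positivity, by positivity, fun n => ?_⟩
  calc ‖A n * B n‖ = ‖A n‖ * ‖B n‖ := norm_mul _ _
    _ ≤ (C * R ^ n) * (D * S ^ n) := by gcongr; exacts [h n, h' n]
    _ = C * D * (R * S) ^ n := by rw [mul_pow]; ring

theorem add (hA : GeomBounded A) (hB : GeomBounded B) : GeomBounded fun n => A n + B n := by
  obtain ⟨C, R, hC, hR, h⟩ := hA
  obtain ⟨D, S, hD, hS, h'⟩ := hB
  refine ⟨C + D, max R S, by positivity, by positivity, fun n => ?_⟩
  calc ‖A n + B n‖ ≤ ‖A n‖ + ‖B n‖ := norm_add_le _ _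
    _ ≤ C * R ^ n + D * S ^ n := add_le_add (h n) (h' n)
    _ ≤ C * (max R S) ^ n + D * (max R S) ^ n := by
      gcongr
      exacts [le_max_left _ _, le_max_right _ _]
    _ = (C + D) * (max R S) ^ n := by ring

theorem const (c : ℂ) : GeomBounded fun _ => c :=
  ⟨‖c‖, 1, norm_nonneg _, zero_le_one, fun n => by simp⟩

theorem natCast : GeomBounded fun n => (n : ℂ) :=
  ⟨1, 2, zero_le_one, zero_le_two, fun n => by
    rw [Complex.norm_natCast, one_mul]
    exact_mod_cast n.lt_two_pow_self.le⟩

theorem pow (y : ℂ) : GeomBounded fun n => y ^ n :=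
  ⟨1, ‖y‖, zero_le_one, norm_nonneg _, fun n => by simp⟩

theorem shift (hA : GeomBounded A) (m : ℕ) : GeomBounded fun n => A (n + m) := by
  obtain ⟨C, R, hC, hR, h⟩ := hA
  exact ⟨C * R ^ m, R, by positivity, hR, fun n => (h _).trans_eq (by ring)⟩

theorem summable_norm (hA : GeomBounded A) (b : ℂ) :
    Summable fun n : ℕ => ‖A n * b ^ n / (n.factorial : ℂ)‖ := by
  obtain ⟨C, R, hC, hR, h⟩ := hA
  refine Summable.of_nonneg_of_le (fun n => norm_nonneg _) (fun n => ?_)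
    ((Real.summable_pow_div_factorial (R * ‖b‖)).mul_left C)
  rw [norm_div, norm_mul, norm_pow, Complex.norm_natCast, mul_pow, mul_div_assoc',
    ← mul_assoc]
  gcongr
  exact h n

theorem hasSum (hA : GeomBounded A) (b : ℂ) :
    HasSum (fun n : ℕ => A n * b ^ n / (n.factorial : ℂ)) (expSeries A b) :=
  (hA.summable_norm b).of_norm.hasSum

/-- On the disc of radius `‖b‖ + 1` the differentiated terms are dominated by their norms at the
radius, which are summable. -/
theorem hasDerivAt (hA : GeomBounded A) (b : ℂ) :
    HasDerivAt (expSeries A) (expSeries (fun n => A (n + 1)) b) b := by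
  set ρ : ℝ := ‖b‖ + 1
  have hρ : 0 ≤ ρ := by positivity
  set u : ℕ → ℝ := fun n => ‖A n * ((n : ℂ) * (ρ : ℂ) ^ (n - 1)) / (n.factorial : ℂ)‖
  have hterm : ∀ (z : ℂ) (n : ℕ), A (n + 1) * (((n + 1 : ℕ) : ℂ) * z ^ (n + 1 - 1)) /
      ((n + 1).factorial : ℂ) = A (n + 1) * z ^ n / (n.factorial : ℂ) := by
    intro z n
    have h1 : (n.factorial : ℂ) ≠ 0 := Nat.cast_ne_zero.2 n.factorial_ne_zero
    have h2 : ((n : ℂ) + 1) ≠ 0 := by exact_mod_cast n.succ_ne_zero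
    rw [Nat.factorial_succ, Nat.add_sub_cancel]
    push_cast
    field_simp
  have hu : Summable u := by
    rw [← summable_nat_add_iff 1]
    simp only [u, hterm]
    exact (hA.shift 1).summable_norm ρ
  have key := hasDerivAt_tsum_of_isPreconnected (𝕜 := ℂ) (u := u)
    (g := fun n z => A n * z ^ n / (n.factorial : ℂ))
    (g' := fun n z => A n * ((n : ℂ) * z ^ (n - 1)) / (n.factorial : ℂ))
    (t := Metric.ball 0 ρ) (y₀ := 0) (y := b) hu Metric.isOpen_ball
    (convex_ball 0 ρ).isPreconnected
    (fun n z _ => ((hasDerivAt_pow n z).const_mul (A n)).div_const _) (fun n z hz => ?_)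
    (by simpa [ρ] using add_pos_of_nonneg_of_pos (norm_nonneg b) one_pos)
    (hA.summable_norm 0).of_norm (by simp [ρ])
  · refine key.congr_deriv ?_
    have hs : Summable fun n : ℕ => A n * ((n : ℂ) * b ^ (n - 1)) / (n.factorial : ℂ) := by
      rw [← summable_nat_add_iff 1]
      simp only [hterm]
      exact ((hA.shift 1).summable_norm b).of_norm
    rw [hs.tsum_eq_zero_add]
    simp only [hterm, expSeries]
    simp
  · simp only [u, norm_div, norm_mul, norm_pow, Complex.norm_real, Real.norm_of_nonneg hρ]
    rw [mem_ball_zero_iff] at hz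
    gcongr

theorem differentiable (hA : GeomBounded A) : Differentiable ℂ (expSeries A) :=
  fun b => (hA.hasDerivAt b).differentiableAt

theorem iteratedDeriv (hA : GeomBounded A) (m : ℕ) :
    iteratedDeriv m (expSeries A) = expSeries fun n => A (n + m) := by
  induction m with
  | zero => simp
  | succ m ih =>
    rw [iteratedDeriv_succ, ih]
    ext b
    rw [((hA.shift m).hasDerivAt b).deriv]
    simp only [expSeries, add_assoc, add_comm 1 m]

theorem expSeries_sum {ι : Type*} (s : Finset ι) {A : ι → ℕ → ℂ}
    (h : ∀ i ∈ s, GeomBounded (A i)) (c : ι → ℂ) (b : ℂ) :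
    expSeries (fun n => ∑ i ∈ s, c i * A i n) b = ∑ i ∈ s, c i * expSeries (A i) b := by
  have h1 := hasSum_sum fun i hi => ((h i hi).hasSum b).mul_left (c i)
  rw [← h1.tsum_eq, expSeries]
  congr 1 with n
  rw [Finset.sum_mul, Finset.sum_div]
  exact Finset.sum_congr rfl fun i _ => by ring

theorem descFactorial (k : ℕ) : GeomBounded fun n : ℕ => (n.descFactorial k : ℂ) := by
  induction k with
  | zero => simpa using const 1
  | succ k ih =>
    have : (fun n : ℕ => (n.descFactorial (k + 1) : ℂ)) =
        fun n : ℕ => ((n : ℂ) + -(k : ℂ)) * (n.descFactorial k : ℂ) := by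
      ext n
      rcases le_or_gt k n with h | h
      · rw [Nat.descFactorial_succ]
        push_cast [h]
        ring
      · rw [Nat.descFactorial_of_lt h, Nat.descFactorial_of_lt (by omega)]
        simp
    rw [this]
    exact (natCast.add (const _)).mul ih

end GeomBounded

/-- `∑ n(n-1)⋯(n-k+1) bⁿ / n! = bᵏ eᵇ`. -/
theorem expSeries_descFactorial (k : ℕ) (b : ℂ) :
    expSeries (fun n : ℕ => (n.descFactorial k : ℂ)) b = b ^ k * Complex.exp b := by
  have h := (GeomBounded.descFactorial k).hasSum b
  rw [← hasSum_nat_add_iff' k] at h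
  have h0 : ∑ i ∈ Finset.range k, (i.descFactorial k : ℂ) * b ^ i / (i.factorial : ℂ) = 0 :=
    Finset.sum_eq_zero fun i hi => by
      rw [Nat.descFactorial_of_lt (Finset.mem_range.1 hi)]
      simp
  rw [h0, sub_zero] at h
  have h' : HasSum (fun n : ℕ => b ^ k * (b ^ n / (n.factorial : ℂ))) (b ^ k * Complex.exp b) := by
    rw [Complex.exp_eq_exp_ℂ]
    exact (NormedSpace.expSeries_div_hasSum_exp b).mul_left _
  refine h.unique (h'.congr_fun fun n => ?_)
  have h1 : ((n + k).factorial : ℂ) ≠ 0 := Nat.cast_ne_zero.2 (n + k).factorial_ne_zero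
  have h2 : (n.factorial : ℂ) ≠ 0 := Nat.cast_ne_zero.2 n.factorial_ne_zero
  have h3 : (n.factorial : ℂ) * ((n + k).descFactorial k : ℂ) = ((n + k).factorial : ℂ) := by
    have := Nat.factorial_mul_descFactorial (Nat.le_add_left k n)
    rw [Nat.add_sub_cancel] at this
    exact_mod_cast this
  rw [← h3] at h1 ⊢
  have h4 := right_ne_zero_of_mul h1
  field_simp
  ring

/-! ### The confluent hypergeometric limit function -/

/-- The coefficients `1 / Γ(α + n + 1)`. -/
def invGamma (α : ℝ) (n : ℕ) : ℝ := (Real.Gamma (α + n + 1))⁻¹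

theorem Gamma_pos_of_neg_one_lt {α : ℝ} (hα : -1 < α) (n : ℕ) : 0 < Real.Gamma (α + n + 1) :=
  Real.Gamma_pos_of_pos (by have : (0 : ℝ) ≤ n := n.cast_nonneg; linarith)

theorem Gamma_succ_add {α : ℝ} (hα : -1 < α) (n : ℕ) :
    Real.Gamma (α + (n + 1 : ℕ) + 1) = (α + n + 1) * Real.Gamma (α + n + 1) := by
  rw [← Real.Gamma_add_one (by have : (0 : ℝ) ≤ n := n.cast_nonneg; linarith)]
  push_cast
  ring_nf

theorem invGamma_nonneg {α : ℝ} (hα : -1 < α) (n : ℕ) : 0 ≤ invGamma α n :=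
  (inv_pos.2 (Gamma_pos_of_neg_one_lt hα n)).le

/-- Shifting the coefficients raises `α`: together with `GeomBounded.iteratedDeriv` this is the
source of `∂ᵐw_α/∂bᵐ = w_{α+m}`. -/
theorem invGamma_add (α : ℝ) (m n : ℕ) : invGamma α (n + m) = invGamma (α + m) n := by
  unfold invGamma
  push_cast
  ring_nf

/-- Consecutive coefficients have ratio `1/(α+n+1) ≤ 1/(α+1)`. -/
theorem geomBounded_invGamma {α : ℝ} (hα : -1 < α) : GeomBounded fun n => (invGamma α n : ℂ) := by
  have hδ : 0 < α + 1 := by linarith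
  refine ⟨invGamma α 0, (α + 1)⁻¹, invGamma_nonneg hα 0, by positivity, fun n => ?_⟩
  rw [Complex.norm_real, Real.norm_of_nonneg (invGamma_nonneg hα n)]
  induction n with
  | zero => simp
  | succ n ih =>
    have h1 : invGamma α (n + 1) = invGamma α n * (α + n + 1)⁻¹ := by
      rw [invGamma, Gamma_succ_add hα, mul_inv, invGamma, mul_comm]
    rw [h1, pow_succ, ← mul_assoc]
    have hn : (0 : ℝ) ≤ n := n.cast_nonneg
    exact mul_le_mul ih (inv_anti₀ hδ (by linarith)) (by rw [inv_nonneg]; linarith)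
      (mul_nonneg (invGamma_nonneg hα 0) (by positivity))

theorem Gamma_mul_ascPochhammer {α : ℝ} (hα : -1 < α) (n : ℕ) :
    Real.Gamma (α + 1) * (ascPochhammer ℝ n).eval (α + 1) = Real.Gamma (α + n + 1) := by
  induction n with
  | zero => simp
  | succ n ih =>
    rw [ascPochhammer_succ_eval, ← mul_assoc, ih, Gamma_succ_add hα]
    ring

theorem ofReal_ascPochhammer_eval (n : ℕ) (c : ℝ) :
    (((ascPochhammer ℝ n).eval c : ℝ) : ℂ) = (ascPochhammer ℂ n).eval (c : ℂ) := by
  have h := Polynomial.eval₂_at_apply (p := ascPochhammer ℝ n) (algebraMap ℝ ℂ) c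
  rw [← Polynomial.eval_map, ascPochhammer_map] at h
  simpa using h.symm

/-- `₀F₁(α + 1; z) / Γ(α + 1) = ∑ zⁿ / (Γ(α + n + 1) n!)`. -/
theorem hyp0F1_eq_expSeries {α : ℝ} (hα : -1 < α) (z : ℂ) :
    hyp0F1 ((α : ℂ) + 1) z =
      (Real.Gamma (α + 1) : ℂ) * expSeries (fun n => (invGamma α n : ℂ)) z := by
  rw [expSeries, ← tsum_mul_left, hyp0F1]
  congr 1 with n
  have h0 : Real.Gamma (α + 1) ≠ 0 := by simpa using (Gamma_pos_of_neg_one_lt hα 0).ne'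
  have h := Gamma_mul_ascPochhammer hα n
  have hn := (Gamma_pos_of_neg_one_lt hα n).ne'
  have hp : (ascPochhammer ℂ n).eval ((α : ℂ) + 1) =
      (((ascPochhammer ℝ n).eval (α + 1) : ℝ) : ℂ) := by
    rw [ofReal_ascPochhammer_eval, Complex.ofReal_add, Complex.ofReal_one]
  have hA : (ascPochhammer ℝ n).eval (α + 1) ≠ 0 := by
    rw [← h] at hn
    exact right_ne_zero_of_mul hn
  rw [hp, invGamma, ← h]
  have h0' : (Real.Gamma (α + 1) : ℂ) ≠ 0 := by exact_mod_cast h0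
  have hA' : (((ascPochhammer ℝ n).eval (α + 1) : ℝ) : ℂ) ≠ 0 := by exact_mod_cast hA
  push_cast
  field_simp

theorem ofReal_hyp0F1 (c z : ℝ) : ((hyp0F1 c z : ℝ) : ℂ) = hyp0F1 (c : ℂ) (z : ℂ) := by
  rw [hyp0F1, hyp0F1, Complex.ofReal_tsum]
  congr 1 with n
  push_cast [ofReal_ascPochhammer_eval]
  rfl

theorem ofReal_weight {α : ℝ} (hα : -1 < α) (b x : ℝ) :
    ((weight α b x : ℝ) : ℂ) = ((x ^ α * Real.exp (-x) : ℝ) : ℂ) *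
      expSeries (fun n => (invGamma α n : ℂ)) ((b : ℂ) * x) := by
  have h0 : (Real.Gamma (α + 1) : ℂ) ≠ 0 := by
    exact_mod_cast (by simpa using (Gamma_pos_of_neg_one_lt hα 0).ne' : Real.Gamma (α + 1) ≠ 0)
  rw [weight, Complex.ofReal_div, Complex.ofReal_mul, ofReal_hyp0F1, Complex.ofReal_add,
    Complex.ofReal_one, hyp0F1_eq_expSeries hα]
  push_cast
  field_simp

/-! ### Moments of the weights -/

theorem hasSum_weight {α : ℝ} (hα : -1 < α) (b x : ℝ) :
    HasSum (fun n : ℕ => x ^ α * Real.exp (-x) * (invGamma α n * (b * x) ^ n / n.factorial))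
      (weight α b x) := by
  rw [← Complex.hasSum_ofReal, ofReal_weight hα]
  have h := ((geomBounded_invGamma hα).hasSum ((b : ℂ) * x)).mul_left
    ((x ^ α * Real.exp (-x) : ℝ) : ℂ)
  refine h.congr_fun fun n => ?_
  push_cast
  ring

theorem continuousOn_weight {α : ℝ} (hα : -1 < α) (b : ℝ) :
    ContinuousOn (weight α b) (Ioi 0) := by
  have h1 : ContinuousOn (fun x : ℝ => ((weight α b x : ℝ) : ℂ)) (Ioi 0) := by
    simp only [ofReal_weight hα]
    refine ContinuousOn.mul ?_ ?_
    · refine Complex.continuous_ofReal.comp_continuousOn (ContinuousOn.mul ?_ (by fun_prop))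
      exact fun x hx => (Real.continuousAt_rpow_const x α (Or.inl (ne_of_gt hx))).continuousWithinAt
    · exact ((geomBounded_invGamma hα).differentiable.continuous.comp (by fun_prop :
        Continuous fun x : ℝ => (b : ℂ) * x)).continuousOn
  exact (Complex.continuous_re.comp_continuousOn h1).congr fun x _ => by simp

theorem geomBounded_ascPochhammer (c : ℝ) (l : ℕ) :
    GeomBounded fun n : ℕ => (((ascPochhammer ℝ l).eval (c + n) : ℝ) : ℂ) := by
  induction l with
  | zero => simpa using GeomBounded.const 1
  | succ l ih =>
    have : (fun n : ℕ => (((ascPochhammer ℝ (l + 1)).eval (c + n) : ℝ) : ℂ)) = fun n : ℕ =>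
        (((ascPochhammer ℝ l).eval (c + n) : ℝ) : ℂ) * ((n : ℂ) + ((c + l : ℝ) : ℂ)) := by
      ext n
      rw [ascPochhammer_succ_eval]
      push_cast
      ring
    rw [this]
    exact ih.mul (GeomBounded.natCast.add (GeomBounded.const _))

/-- Tonelli: the integral of `‖f‖` is at most the sum of the integrals of the `‖F n‖`. -/
theorem integrable_tsum_of_summable_integral_norm {F : ℕ → ℝ → ℝ} {f : ℝ → ℝ} {μ : Measure ℝ}
    (hF : ∀ n, Integrable (F n) μ) (hs : Summable fun n => ∫ x, ‖F n x‖ ∂μ)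
    (hf : AEStronglyMeasurable f μ) (h : ∀ᵐ x ∂μ, HasSum (F · x) (f x)) : Integrable f μ := by
  refine ⟨hf, ?_⟩
  have hle : ∀ᵐ x ∂μ, ‖f x‖ₑ ≤ ∑' n, ‖F n x‖ₑ := by
    filter_upwards [h] with x hx
    rw [← hx.tsum_eq]
    exact enorm_tsum_le_tsum_enorm
  refine (lintegral_mono_ae hle).trans_lt ?_
  rw [lintegral_tsum fun n => (hF n).1.enorm]
  have hn : ∀ n, ∫⁻ x, ‖F n x‖ₑ ∂μ = ENNReal.ofReal (∫ x, ‖F n x‖ ∂μ) := fun n =>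
    (ofReal_integral_norm_eq_lintegral_enorm (hF n)).symm
  simp only [hn]
  exact hs.tsum_ofReal_lt_top

/-- A Gamma integral: the rising factorial is the quotient `Γ(β+n+l+1)/Γ(β+n+1)`. -/
theorem integral_weight_term {β : ℝ} (hβ : -1 < β) (b : ℝ) (l n : ℕ) :
    IntegrableOn (fun x : ℝ => x ^ l * (x ^ β * Real.exp (-x) *
      (invGamma β n * (b * x) ^ n / n.factorial))) (Ioi 0) ∧
    ∫ x in Ioi (0 : ℝ), x ^ l * (x ^ β * Real.exp (-x) *
      (invGamma β n * (b * x) ^ n / n.factorial)) =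
        (ascPochhammer ℝ l).eval (β + 1 + n) * b ^ n / n.factorial := by
  have hn : (0 : ℝ) ≤ n := n.cast_nonneg
  have hl : (0 : ℝ) ≤ l := l.cast_nonneg
  have hpos : 0 < β + n + l + 1 := by linarith
  have e : EqOn (fun x : ℝ => invGamma β n * b ^ n / n.factorial *
      (Real.exp (-x) * x ^ (β + n + l + 1 - 1))) (fun x : ℝ => x ^ l * (x ^ β * Real.exp (-x) *
      (invGamma β n * (b * x) ^ n / n.factorial))) (Ioi 0) := by
    intro x hx
    have hx' : (0 : ℝ) < x := hx
    simp only [add_sub_cancel_right, Real.rpow_add hx', Real.rpow_natCast, mul_pow]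
    ring
  refine ⟨IntegrableOn.congr_fun ((Real.GammaIntegral_convergent hpos).const_mul _) e
    measurableSet_Ioi, ?_⟩
  rw [← setIntegral_congr_fun measurableSet_Ioi e, integral_const_mul,
    ← Real.Gamma_eq_integral hpos, invGamma]
  have h1 := Gamma_mul_ascPochhammer (α := β + n) (by linarith) l
  have h2 := (Gamma_pos_of_neg_one_lt hβ n).ne'
  rw [← h1, add_right_comm β 1 (n : ℝ)]
  field_simp

theorem integrableOn_pow_mul_weight {β : ℝ} (hβ : -1 < β) (b : ℝ) (l : ℕ) :
    IntegrableOn (fun x => x ^ l * weight β b x) (Ioi 0) ∧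
    ((∫ x in Ioi (0 : ℝ), x ^ l * weight β b x : ℝ) : ℂ) =
      expSeries (fun n : ℕ => (((ascPochhammer ℝ l).eval (β + 1 + n) : ℝ) : ℂ)) b := by
  set F : ℕ → ℝ → ℝ := fun n x => x ^ l * (x ^ β * Real.exp (-x) *
    (invGamma β n * (b * x) ^ n / n.factorial))
  have hF : ∀ n, IntegrableOn (F n) (Ioi 0) := fun n => (integral_weight_term hβ b l n).1
  -- Taking norms only replaces `b` by `|b|`, so absolute convergence is the same series at `|b|`.
  have hnorm : ∀ n, ∫ x in Ioi (0 : ℝ), ‖F n x‖ =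
      (ascPochhammer ℝ l).eval (β + 1 + n) * |b| ^ n / n.factorial := fun n => by
    rw [← (integral_weight_term hβ |b| l n).2]
    refine setIntegral_congr_fun measurableSet_Ioi fun x hx => ?_
    have hx' : (0 : ℝ) < x := hx
    simp only [F, norm_mul, norm_div, norm_pow, Real.norm_eq_abs, Nat.abs_cast, Real.abs_exp,
      abs_of_nonneg (invGamma_nonneg hβ n), abs_of_pos hx', abs_of_pos (Real.rpow_pos_of_pos hx' β)]
  have hgeom := geomBounded_ascPochhammer (β + 1) l
  have hs : Summable fun n => ∫ x in Ioi (0 : ℝ), ‖F n x‖ := by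
    simp only [hnorm]
    refine Summable.of_norm ?_
    have h := hgeom.summable_norm ((|b| : ℝ) : ℂ)
    refine h.congr fun n => ?_
    rw [← Complex.norm_real]
    push_cast
    rfl
  have hsum : ∀ x : ℝ, HasSum (F · x) (x ^ l * weight β b x) := fun x =>
    (hasSum_weight hβ b x).mul_left _
  refine ⟨integrable_tsum_of_summable_integral_norm hF hs ?_ (ae_of_all _ hsum), ?_⟩
  · exact ((continuous_pow l).continuousOn.mul (continuousOn_weight hβ b)).aestronglyMeasurable
      measurableSet_Ioi
  · have h := hasSum_integral_of_summable_integral_norm hF hs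
    simp only [fun x => (hsum x).tsum_eq, F, (integral_weight_term hβ b l _).2] at h
    rw [← Complex.hasSum_ofReal] at h
    refine h.unique ((hgeom.hasSum b).congr_fun fun n => ?_)
    push_cast
    rfl

/-! ### Laguerre polynomials -/

/-- The coefficients `binom(l, k) Γ(α + l + 1) / Γ(α + k + 1)` of `l! L_l^α(-x)`. -/
def laguerreCoeff (α : ℝ) (l k : ℕ) : ℝ :=
  (l.choose k : ℝ) * (Real.Gamma (α + l + 1) * invGamma α k)

theorem laguerreCoeff_succ_zero {α : ℝ} (hα : -1 < α) (l : ℕ) :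
    laguerreCoeff α (l + 1) 0 = (α + l + 1) * laguerreCoeff α l 0 := by
  rw [laguerreCoeff, laguerreCoeff, Gamma_succ_add hα]
  simp
  ring

/-- A Lah-type recursion, from Pascal's rule and `(k+1) binom(l,k+1) = (l-k) binom(l,k)`. -/
theorem laguerreCoeff_succ_succ {α : ℝ} (hα : -1 < α) (l k : ℕ) :
    laguerreCoeff α (l + 1) (k + 1) =
      laguerreCoeff α l k + (α + (k + 1 : ℕ) + l + 1) * laguerreCoeff α l (k + 1) := by
  have hk : (0 : ℝ) ≤ k := k.cast_nonneg
  have h1 : invGamma α k = (α + k + 1) * invGamma α (k + 1) := by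
    rw [invGamma, invGamma, Gamma_succ_add hα, mul_inv, mul_inv_cancel_left₀ (by linarith)]
  have h2 : ((l + 1).choose (k + 1) : ℝ) = l.choose k + l.choose (k + 1) := by
    exact_mod_cast Nat.choose_succ_succ l k
  have h3 : (l.choose (k + 1) : ℝ) * (k + 1) = l.choose k * (l - k) := by
    rcases le_or_gt k l with h | h
    · have := Nat.choose_succ_right_eq l k
      rw [← Nat.cast_sub h]
      exact_mod_cast this
    · rw [Nat.choose_eq_zero_of_lt h, Nat.choose_eq_zero_of_lt (by omega)]
      simp
  rw [laguerreCoeff, laguerreCoeff, laguerreCoeff, Gamma_succ_add hα, h1, h2]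
  push_cast
  linear_combination (-Real.Gamma (α + l + 1) * invGamma α (k + 1)) * h3

theorem laguerreCoeff_of_lt (α : ℝ) {l k : ℕ} (h : l < k) : laguerreCoeff α l k = 0 := by
  simp [laguerreCoeff, Nat.choose_eq_zero_of_lt h]

/-- The recursion summed by parts, for an arbitrary sequence `X`, so that it serves both conversions
between rising and falling factorials. -/
theorem sum_laguerreCoeff_succ {α : ℝ} (hα : -1 < α) (l : ℕ) (X : ℕ → ℝ) :
    ∑ k ∈ Finset.range (l + 2), laguerreCoeff α (l + 1) k * X k =
      ∑ k ∈ Finset.range (l + 1), laguerreCoeff α l k * (X (k + 1) + (α + k + l + 1) * X k) := by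
  have h : ∑ k ∈ Finset.range (l + 1), laguerreCoeff α l k * ((α + k + l + 1) * X k) =
      ∑ k ∈ Finset.range (l + 1), laguerreCoeff α l (k + 1) *
        ((α + (k + 1 : ℕ) + l + 1) * X (k + 1)) + laguerreCoeff α l 0 * ((α + l + 1) * X 0) := by
    -- The sum is padded with its vanishing term `k = l + 1` so that the index can be shifted.
    rw [← add_zero (∑ k ∈ Finset.range (l + 1), laguerreCoeff α l k * ((α + k + l + 1) * X k)),
      ← zero_mul ((α + (l + 1 : ℕ) + l + 1) * X (l + 1)),
      ← laguerreCoeff_of_lt α l.lt_succ_self, ← Finset.sum_range_succ, Finset.sum_range_succ']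
    simp
  simp_rw [mul_add (laguerreCoeff α l _) (X _) _]
  rw [Finset.sum_add_distrib, h, Finset.sum_range_succ', laguerreCoeff_succ_zero hα, ← add_assoc,
    ← Finset.sum_add_distrib]
  congr 1
  · refine Finset.sum_congr rfl fun k _ => ?_
    rw [laguerreCoeff_succ_succ hα]
    ring
  · ring

theorem cast_descFactorial_succ (n k : ℕ) :
    (n.descFactorial (k + 1) : ℝ) = ((n : ℝ) - k) * n.descFactorial k := by
  rcases le_or_gt k n with h | h
  · rw [Nat.descFactorial_succ]
    push_cast [h]
    ring
  · rw [Nat.descFactorial_of_lt h, Nat.descFactorial_of_lt (by omega)]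
    simp

/-- The rising factorials `(α + n + 1)_l` in terms of falling factorials of `n`. -/
theorem sum_laguerreCoeff_mul_descFactorial {α : ℝ} (hα : -1 < α) (n l : ℕ) :
    ∑ k ∈ Finset.range (l + 1), laguerreCoeff α l k * (n.descFactorial k : ℝ) =
      (ascPochhammer ℝ l).eval (α + 1 + n) := by
  induction l with
  | zero =>
    have := (Gamma_pos_of_neg_one_lt hα 0).ne'
    simp [laguerreCoeff, invGamma] at this ⊢
    exact mul_inv_cancel₀ this
  | succ l ih =>
    rw [sum_laguerreCoeff_succ hα, ascPochhammer_succ_eval, ← ih, Finset.sum_mul]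
    refine Finset.sum_congr rfl fun k _ => ?_
    -- The factor `(n - k) + (α + k + l + 1)` does not depend on `k`.
    rw [cast_descFactorial_succ]
    ring

/-- The falling factorials of `n` in terms of the rising factorials `(α + n + 1)_l`. -/
theorem sum_laguerreCoeff_mul_ascPochhammer {α : ℝ} (hα : -1 < α) (n i : ℕ) :
    ∑ l ∈ Finset.range (i + 1), laguerreCoeff α i l *
      ((-1) ^ l * (ascPochhammer ℝ l).eval (α + 1 + n)) = (-1) ^ i * (n.descFactorial i : ℝ) := by
  induction i with
  | zero =>
    have := (Gamma_pos_of_neg_one_lt hα 0).ne'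
    simp [laguerreCoeff, invGamma] at this ⊢
    exact mul_inv_cancel₀ this
  | succ i ih =>
    have e : (-1 : ℝ) ^ (i + 1) * (n.descFactorial (i + 1) : ℝ) =
        ((i : ℝ) - n) * ((-1) ^ i * (n.descFactorial i : ℝ)) := by
      rw [cast_descFactorial_succ]
      ring
    rw [sum_laguerreCoeff_succ hα, e, ← ih, Finset.mul_sum]
    -- Here the factor `-(α + 1 + n + l) + (α + l + i + 1) = i - n` does not depend on `l`.
    refine Finset.sum_congr rfl fun l _ => ?_
    rw [ascPochhammer_succ_eval]
    ring

theorem factorial_mul_laguerre (α : ℝ) (i : ℕ) (x : ℝ) :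
    (i.factorial : ℝ) * laguerre α i x =
      ∑ l ∈ Finset.range (i + 1), laguerreCoeff α i l * (-x) ^ l := by
  rw [laguerre, Finset.mul_sum]
  refine Finset.sum_congr rfl fun l hl => ?_
  have hli : l ≤ i := Nat.lt_succ_iff.1 (Finset.mem_range.1 hl)
  rw [laguerreCoeff, invGamma, Nat.cast_choose ℝ hli, add_comm (i : ℝ) α, add_comm (l : ℝ) α]
  have := Nat.factorial_ne_zero l
  have := Nat.factorial_ne_zero (i - l)
  field_simp

variable {N : ℕ}

theorem eta_eq_sum (α : ℝ) (i : Fin N) (x : ℝ) :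
    eta α i x = ∑ l ∈ Finset.range ((i : ℕ) + 1),
      (-1) ^ ((i : ℕ) + l) * laguerreCoeff α i l * x ^ l := by
  rw [eta, mul_assoc, factorial_mul_laguerre, Finset.mul_sum]
  refine Finset.sum_congr rfl fun l _ => ?_
  rw [neg_pow, pow_add]
  ring

/-- The functions `bᵏ eᵇ`, whose derivatives at the parameters are the integrals `∫ η ξ`. -/
def monomialExp (k : ℕ) (b : ℂ) : ℂ := b ^ k * Complex.exp b

theorem monomialExp_eq (k : ℕ) :
    monomialExp k = expSeries fun n : ℕ => (n.descFactorial k : ℂ) :=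
  funext fun b => (expSeries_descFactorial k b).symm

theorem differentiable_monomialExp (k : ℕ) : Differentiable ℂ (monomialExp k) :=
  (differentiable_pow k).mul Complex.differentiable_exp

/-! ### Pairings of the `η_i` and of monomials with the weights -/

/-- The moments of `w_{α+m}` involve `(α+1+(n+m))_l`; the coefficients of `η_i` turn these into
falling factorials of `n+m`, the coefficients of `bⁱ eᵇ` shifted by `m`. -/
theorem integral_eta_mul_weight {α : ℝ} (hα : -1 < α) (i : Fin N) (m : ℕ) (b : ℝ) :
    IntegrableOn (fun x => eta α i x * weight (α + m) b x) (Ioi 0) ∧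
    ((∫ x in Ioi (0 : ℝ), eta α i x * weight (α + m) b x : ℝ) : ℂ) =
      iteratedDeriv m (monomialExp i) b := by
  have hαm : -1 < α + m := by have : (0 : ℝ) ≤ m := m.cast_nonneg; linarith
  have h := fun l => integrableOn_pow_mul_weight hαm b l
  have e : ∀ x, eta α i x * weight (α + m) b x = ∑ l ∈ Finset.range ((i : ℕ) + 1),
      (-1) ^ ((i : ℕ) + l) * laguerreCoeff α i l * (x ^ l * weight (α + m) b x) := fun x => by
    rw [eta_eq_sum, Finset.sum_mul]
    exact Finset.sum_congr rfl fun l _ => by ring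
  simp only [e]
  refine ⟨integrable_finsetSum _ fun l _ => (h l).1.const_mul _, ?_⟩
  rw [integral_finsetSum _ fun l _ => (h l).1.const_mul _, Complex.ofReal_sum]
  simp only [integral_const_mul, Complex.ofReal_mul, (h _).2]
  rw [← GeomBounded.expSeries_sum _ (fun l _ => geomBounded_ascPochhammer _ l), monomialExp_eq,
    (GeomBounded.descFactorial i).iteratedDeriv]
  congr 1 with n
  have := sum_laguerreCoeff_mul_ascPochhammer hα (n + m) i
  have h2 : ((n + m).descFactorial i : ℝ) = ∑ l ∈ Finset.range ((i : ℕ) + 1),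
      (-1) ^ ((i : ℕ) + l) * laguerreCoeff α i l *
        (ascPochhammer ℝ l).eval (α + m + 1 + n) := by
    have h1 : ((n + m).descFactorial i : ℝ) =
        (-1) ^ (i : ℕ) * ((-1) ^ (i : ℕ) * ((n + m).descFactorial i : ℝ)) := by
      rw [← mul_assoc, ← mul_pow]
      norm_num
    rw [h1, ← this, Finset.mul_sum]
    refine Finset.sum_congr rfl fun l _ => ?_
    rw [show α + 1 + ((n + m : ℕ) : ℝ) = α + m + 1 + n by push_cast; ring, pow_add]
    ring
  rw [← Complex.ofReal_natCast, h2]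
  push_cast
  rfl

/-- The inverse conversion: rising factorials expand in falling ones, whose generating functions at
`-x` are `(-x)ᵏ e^{-x}`. -/
theorem integral_pow_mul_weight_neg {α : ℝ} (hα : -1 < α) (i : Fin N) (x : ℝ) :
    ∫ u in Ioi (0 : ℝ), (-u) ^ (i : ℕ) * weight α (-x) u = Real.exp (-x) * eta α i x := by
  have h := (integrableOn_pow_mul_weight hα (-x) i).2
  simp only [← sum_laguerreCoeff_mul_descFactorial hα, Complex.ofReal_sum, Complex.ofReal_mul,
    Complex.ofReal_natCast] at h
  rw [GeomBounded.expSeries_sum _ fun l _ => GeomBounded.descFactorial l] at h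
  simp only [expSeries_descFactorial] at h
  have e : ∀ u, (-u) ^ (i : ℕ) * weight α (-x) u = (-1) ^ (i : ℕ) * (u ^ (i : ℕ) *
      weight α (-x) u) := fun u => by
    rw [neg_pow]
    ring
  simp only [e]
  rw [integral_const_mul, eta, mul_assoc, factorial_mul_laguerre, mul_left_comm]
  congr 1
  rw [← Complex.ofReal_inj, h]
  push_cast
  rw [Finset.mul_sum]
  exact Finset.sum_congr rfl fun l _ => by ring

theorem integrableOn_xi {α : ℝ} (hα : -1 < α) (a : Fin N → ℝ) (i j : Fin N) :
    IntegrableOn (fun x => eta α i x * xi α a j x) (Ioi 0) :=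
  (integral_eta_mul_weight hα i _ _).1

theorem gram_apply {α : ℝ} (hα : -1 < α) (a : Fin N → ℝ) (i j : Fin N) :
    ((gram (Ioi 0) (eta α) (xi α a) i j : ℝ) : ℂ) =
      iteratedDeriv (priorMultiplicity a j) (monomialExp i) (a j) :=
  (integral_eta_mul_weight hα i _ _).2

/-! ### Division by the node polynomial -/

/-- One derivative leaves `(v-c)^m` times a function with value `(m+1) g(c)` at `c`. -/
theorem iteratedDeriv_sub_pow_mul (m : ℕ) (c : ℂ) {g : ℂ → ℂ} (hg : Differentiable ℂ g) :
    iteratedDeriv m (fun v => (v - c) ^ m * g v) c = (m.factorial : ℂ) * g c := by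
  induction m generalizing g with
  | zero => simp
  | succ m ih =>
    have hd : deriv (fun v => (v - c) ^ (m + 1) * g v) =
        fun v => (v - c) ^ m * (((m : ℂ) + 1) * g v + (v - c) * deriv g v) := by
      ext v
      have h := (((hasDerivAt_id v).sub_const c).fun_pow (m + 1)).fun_mul (hg v).hasDerivAt
      simp only [id] at h
      rw [h.deriv]
      push_cast
      ring
    have hg' : Differentiable ℂ (deriv g) := (hg.contDiff (n := 2)).differentiable_deriv_two
    have hs : Differentiable ℂ fun v => ((m : ℂ) + 1) * g v + (v - c) * deriv g v :=
      (hg.const_mul _).add ((differentiable_id.sub_const c).mul hg')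
    rw [iteratedDeriv_succ', hd, ih hs, Nat.factorial_succ]
    push_cast
    ring

variable {N : ℕ}

/-- A function whose derivatives of order `priorMultiplicity a j` vanish at all the nodes `a j` is
divisible by `∏ (v - a j)`, within any class of entire functions closed under division by
linear factors. -/
theorem exists_eq_prod_mul_of_iteratedDeriv_eq_zero (S : (ℂ → ℂ) → Prop)
    (hS : ∀ g, S g → Differentiable ℂ g)
    (hdiv : ∀ g, S g → ∀ c, g c = 0 → ∃ q, S q ∧ ∀ v, g v = (v - c) * q v)
    (a : Fin N → ℝ) {φ : ℂ → ℂ} (hφ : S φ)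
    (h : ∀ j, iteratedDeriv (priorMultiplicity a j) φ (a j) = 0) :
    ∃ q, S q ∧ ∀ v, φ v = (∏ j, (v - a j)) * q v := by
  have key : ∀ k ≤ N, ∃ q, S q ∧
      ∀ v, φ v = (∏ j ∈ Finset.univ.filter (fun j : Fin N => (j : ℕ) < k), (v - a j)) * q v := by
    intro k
    induction k with
    | zero => exact fun _ => ⟨φ, hφ, fun v => by simp⟩
    | succ k ih =>
      intro hk
      obtain ⟨g, hg, hφg⟩ := ih (by omega)
      set i : Fin N := ⟨k, hk⟩
      -- Nodes are removed in index order, so those already removed that equal `a i` number exactly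
      -- `priorMultiplicity a i`.
      have hsplit : ∀ v : ℂ, ∏ j ∈ Finset.univ.filter (fun j : Fin N => (j : ℕ) < k), (v - a j) =
          (v - a i) ^ priorMultiplicity a i *
            ∏ j ∈ Finset.univ.filter (fun j : Fin N => j < i ∧ ¬ a j = a i), (v - a j) := by
        intro v
        have hlt : Finset.univ.filter (fun j : Fin N => (j : ℕ) < k) =
            Finset.univ.filter fun j => j < i := by
          ext j
          simp [Fin.lt_def, i]
        rw [hlt, ← Finset.prod_filter_mul_prod_filter_not _ (fun j => a j = a i),
          Finset.filter_filter, Finset.filter_filter, priorMultiplicity]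
        congr 1
        refine Finset.prod_eq_pow_card fun j hj => ?_
        rw [(Finset.mem_filter.1 hj).2.2]
      set r : ℂ → ℂ := fun v =>
        ∏ j ∈ Finset.univ.filter (fun j : Fin N => j < i ∧ ¬ a j = a i), (v - a j)
      have hr : Differentiable ℂ r :=
        Differentiable.fun_finsetProd fun j _ => differentiable_id.sub_const _
      have hri : r (a i) ≠ 0 := Finset.prod_ne_zero_iff.2 fun j hj => by
        have := (Finset.mem_filter.1 hj).2.2
        exact sub_ne_zero.2 fun h => this (Complex.ofReal_injective h.symm)
      have hφ' : φ = fun v => (v - a i) ^ priorMultiplicity a i * (r v * g v) := by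
        ext v
        rw [hφg, hsplit, mul_assoc]
      -- The derivative at `a i` is a factorial times `r (a i) * g (a i)` with `r (a i) ≠ 0`, which
      -- forces `g (a i) = 0`.
      have hi := h i
      rw [hφ', iteratedDeriv_sub_pow_mul _ _ (hr.fun_mul (hS g hg))] at hi
      have hgi : g (a i) = 0 := by
        rcases mul_eq_zero.1 hi with h0 | h0
        · exact absurd h0 (Nat.cast_ne_zero.2 (Nat.factorial_ne_zero _))
        · exact (mul_eq_zero.1 h0).resolve_left hri
      obtain ⟨q, hq, hgq⟩ := hdiv g hg _ hgi
      refine ⟨q, hq, fun v => ?_⟩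
      have hins : Finset.univ.filter (fun j : Fin N => (j : ℕ) < k + 1) =
          insert i (Finset.univ.filter fun j : Fin N => (j : ℕ) < k) := by
        ext j
        simp [Fin.ext_iff, i]
        omega
      rw [hins, Finset.prod_insert (by simp [i]), hφg, hgq]
      ring
  obtain ⟨q, hq, h⟩ := key N le_rfl
  refine ⟨q, hq, fun v => ?_⟩
  rw [h, Finset.filter_true_of_mem fun j _ => j.2]

theorem Differentiable.exists_eq_sub_mul {g : ℂ → ℂ} (hg : Differentiable ℂ g) {c : ℂ}
    (hc : g c = 0) : ∃ q, Differentiable ℂ q ∧ ∀ v, g v = (v - c) * q v := by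
  refine ⟨dslope g c, ?_, fun v => ?_⟩
  · rw [← differentiableOn_univ, Complex.differentiableOn_dslope univ_mem]
    exact hg.differentiableOn
  · have := sub_smul_dslope g c v
    rw [hc, sub_zero, smul_eq_mul] at this
    exact this.symm

/-! ### Non-singularity of the Gram matrix -/

theorem iteratedDeriv_sum_monomialExp (m : ℕ) (d : Fin N → ℂ) (z : ℂ) :
    iteratedDeriv m (fun b => ∑ i : Fin N, d i * monomialExp i b) z =
      ∑ i : Fin N, d i * iteratedDeriv m (monomialExp i) z := by
  rw [iteratedDeriv_fun_sum fun (i : Fin N) _ =>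
    (((differentiable_monomialExp i).const_mul (d i)).contDiff (n := m)).contDiffAt]
  simp only [iteratedDeriv_const_mul_field]

open Polynomial in
/-- The confluent Vandermonde matrix of the parameters is non-singular. -/
theorem isUnit_det_gram {α : ℝ} (hα : -1 < α) (a : Fin N → ℝ) :
    IsUnit (gram (Ioi 0) (eta α) (xi α a)).det := by
  rw [isUnit_iff_ne_zero]
  intro hdet
  obtain ⟨d, hd, hdg⟩ := Matrix.exists_vecMul_eq_zero_iff.2 hdet
  set P : ℂ[X] := ∑ i : Fin N, C (d i : ℂ) * X ^ (i : ℕ) with hP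
  have hφ : (fun b => ∑ i : Fin N, (d i : ℂ) * monomialExp i b) =
      fun b => P.eval b * Complex.exp b := by
    ext b
    simp only [hP, eval_finsetSum, eval_mul, eval_C, eval_pow, eval_X, monomialExp, Finset.sum_mul,
      mul_assoc]
  have hvan : ∀ j, iteratedDeriv (priorMultiplicity a j) (fun b => P.eval b * Complex.exp b)
      (a j) = 0 := by
    intro j
    rw [← hφ, iteratedDeriv_sum_monomialExp]
    have := congrFun hdg j
    simp only [Matrix.vecMul, dotProduct, Pi.zero_apply] at this
    simp only [← gram_apply hα]
    exact_mod_cast this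
  -- Division stays within polynomials times `exp`, so the quotient has a degree to compare.
  obtain ⟨q, ⟨Q, rfl⟩, hQ⟩ := exists_eq_prod_mul_of_iteratedDeriv_eq_zero
    (fun g => ∃ Q : ℂ[X], g = fun b => Q.eval b * Complex.exp b)
    (by
      rintro _ ⟨Q, rfl⟩
      exact Q.differentiable.mul Complex.differentiable_exp)
    (by
      rintro _ ⟨Q, rfl⟩ c hc
      have hroot : Q.IsRoot c := (mul_eq_zero.1 hc).resolve_right (Complex.exp_ne_zero c)
      obtain ⟨R, rfl⟩ := dvd_iff_isRoot.2 hroot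
      exact ⟨_, ⟨R, rfl⟩, fun v => by simp [mul_assoc]⟩)
    a ⟨P, rfl⟩ hvan
  have hPQ : P = (∏ j, (X - C (a j : ℂ))) * Q := by
    refine Polynomial.funext fun v => ?_
    have := hQ v
    rw [← mul_assoc] at this
    rw [mul_right_cancel₀ (Complex.exp_ne_zero v) this]
    simp [eval_prod]
  have hPdeg : P.degree < N := degree_sum_fin_lt _
  have hP0 : P = 0 := by
    by_contra hne
    have hQ0 : Q ≠ 0 := by
      rintro rfl
      exact hne (by simpa using hPQ)
    have hdeg : (∏ j, (X - C (a j : ℂ))).degree = (N : WithBot ℕ) := by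
      rw [degree_prod]
      simp
    rw [hPQ, degree_mul, hdeg] at hPdeg
    have : (0 : WithBot ℕ) ≤ Q.degree := zero_le_degree_iff.2 hQ0
    exact absurd hPdeg (not_lt.2 (le_add_of_nonneg_right this))
  refine hd (funext fun k => ?_)
  have hk : P.coeff k = d k := by
    simp [hP, coeff_X_pow, Fin.val_inj]
  rw [hP0, coeff_zero] at hk
  exact_mod_cast hk.symm

/-! ### The kernel as an interpolation polynomial -/

/-- The coefficients `∑ⱼ c i j ξ j (y)` of the kernel with respect to the `η i`. -/
def kernelCoeff (α : ℝ) (a : Fin N → ℝ) (y : ℝ) : Fin N → ℝ :=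
  Matrix.vecMul (fun j => xi α a j y) (gram (Ioi 0) (eta α) (xi α a))⁻¹

theorem kernel_eq_sum (α : ℝ) (a : Fin N → ℝ) (x y : ℝ) :
    kernel α a x y = ∑ i, kernelCoeff α a y i * eta α i x := by
  simp only [kernel, biorthogonalKernel, kernelCoeff, Matrix.vecMul, dotProduct, Finset.sum_mul,
    Matrix.transpose_apply]
  exact Finset.sum_congr rfl fun i _ => Finset.sum_congr rfl fun j _ => by ring

theorem sum_kernelCoeff_mul_gram {α : ℝ} (hα : -1 < α) (a : Fin N → ℝ) (y : ℝ) (k : Fin N) :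
    ∑ i, kernelCoeff α a y i * gram (Ioi 0) (eta α) (xi α a) i k = xi α a k y := by
  have h : Matrix.vecMul (kernelCoeff α a y) (gram (Ioi 0) (eta α) (xi α a)) =
      fun j => xi α a j y := by
    rw [kernelCoeff, Matrix.vecMul_vecMul, Matrix.nonsing_inv_mul _ (isUnit_det_gram hα a),
      Matrix.vecMul_one]
  exact congrFun h k

/-- The weight `w_α(y, b)` as an entire function of `b`. -/
def weightExt (α y : ℝ) (b : ℂ) : ℂ :=
  ((y ^ α * Real.exp (-y) : ℝ) : ℂ) * expSeries (fun n => (invGamma α n : ℂ)) (b * y)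

theorem differentiable_weightExt {α : ℝ} (hα : -1 < α) (y : ℝ) :
    Differentiable ℂ (weightExt α y) :=
  ((geomBounded_invGamma hα).differentiable.comp (differentiable_id.mul_const _)).const_mul _

/-- With `yⁿ` absorbed in the coefficients, a shift by `m` yields both `invGamma (α + m)` and the
factor `y^m` that turns `y^α` into `y^(α+m)`. -/
theorem iteratedDeriv_weightExt {α : ℝ} (hα : -1 < α) {y : ℝ} (hy : 0 < y) (m : ℕ) (b : ℝ) :
    iteratedDeriv m (weightExt α y) b = (weight (α + m) b y : ℂ) := by
  have hαm : -1 < α + m := by have : (0 : ℝ) ≤ m := m.cast_nonneg; linarith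
  have hA : GeomBounded fun n => (invGamma α n : ℂ) * (y : ℂ) ^ n :=
    (geomBounded_invGamma hα).mul (GeomBounded.pow _)
  have e : weightExt α y = fun b => ((y ^ α * Real.exp (-y) : ℝ) : ℂ) *
      expSeries (fun n => (invGamma α n : ℂ) * (y : ℂ) ^ n) b := by
    ext b
    simp only [weightExt, expSeries, mul_pow]
    congr 2 with n
    ring
  rw [e, iteratedDeriv_const_mul_field, hA.iteratedDeriv, ofReal_weight hαm, expSeries, expSeries,
    ← tsum_mul_left, ← tsum_mul_left]
  congr 1 with n
  rw [invGamma_add, Real.rpow_add hy, Real.rpow_natCast]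
  push_cast
  ring

open Polynomial in
/-- The interpolation polynomial of `eᵛ w_α(y, -v)` at the nodes `-a j`. -/
def kernelPoly (α : ℝ) (a : Fin N → ℝ) (y : ℝ) : ℂ[X] :=
  ∑ i : Fin N, C ((-1) ^ (i : ℕ) * (kernelCoeff α a y i : ℂ)) * X ^ (i : ℕ)

theorem eval_kernelPoly (α : ℝ) (a : Fin N → ℝ) (y : ℝ) (v : ℂ) :
    (kernelPoly α a y).eval v = ∑ i : Fin N, (kernelCoeff α a y i : ℂ) * (-v) ^ (i : ℕ) := by
  rw [kernelPoly, Polynomial.eval_finsetSum]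
  refine Finset.sum_congr rfl fun i _ => ?_
  rw [neg_pow]
  simp only [Polynomial.eval_mul, Polynomial.eval_C, Polynomial.eval_pow, Polynomial.eval_X]
  ring

theorem degree_kernelPoly_lt (α : ℝ) (a : Fin N → ℝ) (y : ℝ) : (kernelPoly α a y).degree < N :=
  Polynomial.degree_sum_fin_lt _

/-- By the choice of `kernelCoeff`, the difference of `w_α(y,b)` and `∑ κ_i bⁱ eᵇ` vanishes to the
required orders at the `a j`, hence is divisible by the node polynomial; then `b = -v`. -/
theorem exists_exp_mul_weightExt_eq {α : ℝ} (hα : -1 < α) (a : Fin N → ℝ) {y : ℝ} (hy : 0 < y) :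
    ∃ q : ℂ → ℂ, Differentiable ℂ q ∧ ∀ v, Complex.exp v * weightExt α y (-v) =
      (kernelPoly α a y).eval v + (∏ i, (v + a i)) * q v := by
  have hM : Differentiable ℂ fun b => ∑ i : Fin N, (kernelCoeff α a y i : ℂ) * monomialExp i b :=
    Differentiable.fun_sum fun i _ => (differentiable_monomialExp i).const_mul _
  have hW := differentiable_weightExt hα y
  obtain ⟨q, hq, h⟩ := exists_eq_prod_mul_of_iteratedDeriv_eq_zero (fun g => Differentiable ℂ g)
    (fun _ h => h) (fun g hg c hc => Differentiable.exists_eq_sub_mul hg hc) a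
    (hW.fun_sub hM) (fun j => by
      rw [iteratedDeriv_fun_sub hW.contDiff.contDiffAt hM.contDiff.contDiffAt,
        iteratedDeriv_weightExt hα hy, iteratedDeriv_sum_monomialExp]
      simp only [← gram_apply hα]
      rw [sub_eq_zero, ← xi, ← sum_kernelCoeff_mul_gram hα]
      push_cast
      rfl)
  refine ⟨fun v => (-1) ^ N * (Complex.exp v * q (-v)), ?_, fun v => ?_⟩
  · exact (Complex.differentiable_exp.mul (hq.comp differentiable_neg)).const_mul _
  · have hprod : ∏ i, (-v - (a i : ℂ)) = (-1) ^ N * ∏ i, (v + a i) := by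
      have : ∀ i, -v - (a i : ℂ) = -1 * (v + a i) := fun i => by ring
      simp only [this]
      rw [Finset.prod_mul_distrib, Finset.prod_const, Finset.card_univ, Fintype.card_fin]
    have h1 := h (-v)
    rw [hprod] at h1
    have h2 : Complex.exp v * ∑ i : Fin N, (kernelCoeff α a y i : ℂ) * monomialExp i (-v) =
        (kernelPoly α a y).eval v := by
      rw [eval_kernelPoly, Finset.mul_sum]
      refine Finset.sum_congr rfl fun i _ => ?_
      have := Complex.exp_ne_zero v
      rw [monomialExp, Complex.exp_neg]
      field_simp
    linear_combination Complex.exp v * h1 + h2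

/-! ### The double integral -/

theorem hyp0F1_eq_weight {α : ℝ} (hα : -1 < α) (x u : ℝ) :
    u ^ α * Real.exp (-u) * hyp0F1 (α + 1) (-(x * u)) =
      Real.Gamma (α + 1) * weight α (-x) u := by
  have h0 : Real.Gamma (α + 1) ≠ 0 := by simpa using (Gamma_pos_of_neg_one_lt hα 0).ne'
  rw [weight, neg_mul]
  field_simp

/-- Hermite's formula evaluates the `v`-integral as a polynomial in `u`. The result is free of `C`,
which lets the contour vary arbitrarily with `u`. -/
theorem doubleIntegrand_eq {α : ℝ} (hα : -1 < α) (a : Fin N → ℝ) (x : ℝ) {y : ℝ} (hy : 0 < y)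
    {C : Contour} {u : ℝ} (hC : C.Separates a u) :
    doubleIntegrand α a x y C u = ((Real.Gamma (α + 1) ^ 2 / (y ^ α * Real.exp (-y)) *
      ∑ i, kernelCoeff α a y i * ((-u) ^ (i : ℕ) * weight α (-x) u) : ℝ) : ℂ) := by
  obtain ⟨q, hq, hf⟩ := exists_exp_mul_weightExt_eq hα a hy
  have hL := C.cauchyFunctional_eq_of_sub_eq Finset.univ (fun i => (a i : ℂ)) u
    (fun i _ => hC.1 i) hC.2 hq (kernelPoly α a y) (by simpa using degree_kernelPoly_lt α a y) hf
  have hy0 : ((y ^ α * Real.exp (-y) : ℝ) : ℂ) ≠ 0 := by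
    exact_mod_cast (mul_pos (Real.rpow_pos_of_pos hy α) (Real.exp_pos _)).ne'
  have hint : (C.integral fun v => Complex.exp v * hyp0F1 ((α : ℂ) + 1) (-(y * v)) / (u - v) *
      ∏ i, (u + (a i : ℂ)) / (v + a i)) =
      Real.Gamma (α + 1) / ((y ^ α * Real.exp (-y) : ℝ) : ℂ) * (kernelPoly α a y).eval (u : ℂ) := by
    rw [← hL, Contour.cauchyFunctional, ← Contour.integral_const_mul]
    refine C.integral_congr fun v _ => ?_
    rw [hyp0F1_eq_expSeries hα, weightExt, neg_mul, mul_comm v]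
    field_simp
  rw [doubleIntegrand, hint, hyp0F1_eq_weight hα, eval_kernelPoly]
  push_cast
  simp only [Finset.mul_sum]
  exact Finset.sum_congr rfl fun i _ => by ring

theorem integrableOn_sum_kernelCoeff {α : ℝ} (hα : -1 < α) (a : Fin N → ℝ) (x y : ℝ) :
    IntegrableOn (fun u => ∑ i, kernelCoeff α a y i * ((-u) ^ (i : ℕ) * weight α (-x) u))
      (Ioi 0) ∧
    ∫ u in Ioi (0 : ℝ), ∑ i, kernelCoeff α a y i * ((-u) ^ (i : ℕ) * weight α (-x) u) =
      Real.exp (-x) * kernel α a x y := by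
  have h : ∀ i : Fin N, IntegrableOn (fun u => kernelCoeff α a y i *
      ((-u) ^ (i : ℕ) * weight α (-x) u)) (Ioi 0) := fun i => by
    refine Integrable.const_mul ?_ _
    refine ((integrableOn_pow_mul_weight hα (-x) i).1.const_mul ((-1) ^ (i : ℕ))).congr
      (ae_of_all _ fun u => ?_)
    simp only
    rw [neg_pow u, mul_assoc]
  refine ⟨integrable_finsetSum _ fun i _ => h i, ?_⟩
  rw [integral_finsetSum _ fun i _ => h i, kernel_eq_sum, Finset.mul_sum]
  refine Finset.sum_congr rfl fun i _ => ?_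
  rw [integral_const_mul, integral_pow_mul_weight_neg hα]
  ring

/-! ### Bessel-type contour integrals -/

namespace Contour

theorem exists_norm_le (C : Contour) {f : ℂ → ℂ} (hf : ContinuousOn f C.support) :
    ∃ R : ℝ, 0 ≤ R ∧ ∀ z ∈ C.support, ‖f z‖ ≤ R := by
  obtain ⟨R, hR⟩ := C.isCompact_support.exists_bound_of_continuousOn hf
  exact ⟨|R|, abs_nonneg R, fun z hz => (hR z hz).trans (le_abs_self R)⟩

/-- Both exponentials are expanded and integrated termwise, with bounds for `z`, `z⁻¹` and `z ^ k`
on the compact support; only the power `-1` survives. -/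
theorem hasSum_integral_exp_mul_exp_mul_zpow (C : Contour) (hC : C.Encircles 0) (A B : ℂ) (k : ℤ) :
    HasSum (fun p : ℕ × ℕ => A ^ p.1 / (p.1.factorial : ℂ) * (B ^ p.2 / (p.2.factorial : ℂ)) *
      if (p.1 : ℤ) - p.2 + k = -1 then 1 else 0)
      (C.integral fun w => Complex.exp (A * w) * Complex.exp (B / w) * w ^ k) := by
  have hne : ∀ z ∈ C.support, z ≠ 0 := fun z hz h => hC.1 (h ▸ hz)
  obtain ⟨R, hR, hRb⟩ := C.exists_norm_le continuousOn_id
  obtain ⟨S, hS, hSb⟩ := C.exists_norm_le (f := fun z => z⁻¹) (continuousOn_id.inv₀ hne)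
  obtain ⟨T, hT, hTb⟩ := C.exists_norm_le (f := fun z => z ^ k)
    (continuousOn_id.zpow₀ k fun z hz => Or.inl (hne z hz))
  have hterm : ∀ z ∈ C.support, ∀ p : ℕ × ℕ, A ^ p.1 / (p.1.factorial : ℂ) *
      (B ^ p.2 / (p.2.factorial : ℂ)) * z ^ ((p.1 : ℤ) - p.2 + k) =
      (A * z) ^ p.1 / (p.1.factorial : ℂ) * ((B / z) ^ p.2 / (p.2.factorial : ℂ)) * z ^ k := by
    intro z hz p
    rw [zpow_add₀ (hne z hz), zpow_sub₀ (hne z hz), zpow_natCast, zpow_natCast]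
    ring
  have hexp : ∀ z : ℂ, HasSum (fun n : ℕ => z ^ n / (n.factorial : ℂ)) (Complex.exp z) := fun z => by
    rw [Complex.exp_eq_exp_ℂ]
    exact NormedSpace.expSeries_div_hasSum_exp z
  have hnorm : ∀ z : ℂ, Summable fun n : ℕ => ‖z ^ n / (n.factorial : ℂ)‖ := fun z => by
    simpa using Real.summable_pow_div_factorial ‖z‖
  have h := C.hasSum_integral (ι := ℕ × ℕ)
    (f := fun p z => A ^ p.1 / (p.1.factorial : ℂ) *
      (B ^ p.2 / (p.2.factorial : ℂ)) * z ^ ((p.1 : ℤ) - p.2 + k))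
    (g := fun w => Complex.exp (A * w) * Complex.exp (B / w) * w ^ k)
    (b := fun p => (‖A‖ * R) ^ p.1 / p.1.factorial * ((‖B‖ * S) ^ p.2 / p.2.factorial) * T)
    (fun p => continuousOn_const.mul (continuousOn_id.zpow₀ _ fun z hz => Or.inl (hne z hz)))
    (((Real.summable_pow_div_factorial (‖A‖ * R)).mul_of_nonneg
      (Real.summable_pow_div_factorial (‖B‖ * S)) (fun _ => by positivity)
      (fun _ => by positivity)).mul_right T)
    (fun p z hz => ?_) (fun z hz => ?_)
  · refine h.congr_fun fun p => ?_
    rw [integral_const_mul, C.integral_zpow hC]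
  · rw [hterm z hz]
    simp only [norm_mul, norm_div, norm_pow, Complex.norm_natCast, div_eq_mul_inv B z]
    have h1 := hRb z hz
    have h2 := hSb z hz
    have h3 := hTb z hz
    simp only [id] at h1 h2 h3
    gcongr
  · refine HasSum.congr_fun ?_ (hterm z hz)
    have hs := summable_mul_of_summable_norm (hnorm (A * z)) (hnorm (B / z))
    exact ((hexp (A * z)).mul (hexp (B / z)) hs).mul_right (z ^ k)

theorem invGamma_natCast (m n : ℕ) : invGamma (m : ℝ) n = (((n + m).factorial : ℕ) : ℝ)⁻¹ := by
  rw [invGamma, ← Nat.cast_add, Real.Gamma_nat_eq_factorial, add_comm]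

theorem neg_one_lt_natCast (m : ℕ) : (-1 : ℝ) < m := by
  have : (0 : ℝ) ≤ m := m.cast_nonneg
  linarith

theorem integral_exp_mul_exp_mul_zpow_neg (C : Contour) (hC : C.Encircles 0) (A B : ℂ) (m : ℕ) :
    (C.integral fun w => Complex.exp (A * w) * Complex.exp (B / w) * w ^ (-(m : ℤ) - 1)) =
      A ^ m * expSeries (fun n => (invGamma m n : ℂ)) (A * B) := by
  have h := C.hasSum_integral_exp_mul_exp_mul_zpow hC A B (-(m : ℤ) - 1)
  -- The surviving pairs are those with `p.1 = p.2 + m`.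
  have hinj : Function.Injective fun n : ℕ => (n + m, n) := fun n n' h => (Prod.ext_iff.1 h).2
  rw [← hinj.hasSum_iff] at h
  · refine h.unique ?_
    have h' := ((geomBounded_invGamma (neg_one_lt_natCast m)).hasSum (A * B)).mul_left (A ^ m)
    refine h'.congr_fun fun n => ?_
    have e : (((n + m : ℕ) : ℤ) - (n : ℤ) + (-(m : ℤ) - 1) = -1) := by push_cast; ring
    simp only [Function.comp, if_pos e, invGamma_natCast]
    push_cast
    ring
  · rintro ⟨i, j⟩ hij
    refine mul_eq_zero_of_right _ (if_neg fun h0 => hij ⟨j, Prod.ext ?_ rfl⟩)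
    simp only at h0 ⊢
    omega

theorem integral_exp_mul_exp_mul_zpow_sub_one (C : Contour) (hC : C.Encircles 0) (A B : ℂ)
    (m : ℕ) :
    (C.integral fun w => Complex.exp (A * w) * Complex.exp (B / w) * w ^ ((m : ℤ) - 1)) =
      B ^ m * expSeries (fun n => (invGamma m n : ℂ)) (A * B) := by
  have h := C.hasSum_integral_exp_mul_exp_mul_zpow hC A B ((m : ℤ) - 1)
  -- The surviving pairs are those with `p.2 = p.1 + m`.
  have hinj : Function.Injective fun n : ℕ => (n, n + m) := fun n n' h => (Prod.ext_iff.1 h).1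
  rw [← hinj.hasSum_iff] at h
  · refine h.unique ?_
    have h' := ((geomBounded_invGamma (neg_one_lt_natCast m)).hasSum (A * B)).mul_left (B ^ m)
    refine h'.congr_fun fun n => ?_
    have e : ((n : ℤ) - ((n + m : ℕ) : ℤ) + ((m : ℤ) - 1) = -1) := by push_cast; ring
    simp only [Function.comp, if_pos e, invGamma_natCast]
    push_cast
    ring
  · rintro ⟨i, j⟩ hij
    refine mul_eq_zero_of_right _ (if_neg fun h0 => hij ⟨i, Prod.ext rfl ?_⟩)
    simp only at h0 ⊢
    omega

end Contour

variable {N : ℕ}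

/-- The `w`- and `z`-integrals separate into `x^m` and `v^m` times series for `₀F₁`. The `v^m`
cancels the pole of `(u/v)^m`, leaving the `u^m` of the double integrand. -/
theorem quadrupleIntegrand_eq (m : ℕ) (a : Fin N → ℝ) (x y : ℝ) {Cw Cz C : Contour}
    (hw : Cw.Encircles 0) (hz : Cz.Encircles 0) (h0 : (0 : ℂ) ∉ C.support) {u : ℝ} :
    quadrupleIntegrand m a x y Cw Cz C u =
      ((x ^ m / Real.Gamma ((m : ℝ) + 1) ^ 2 : ℝ) : ℂ) * doubleIntegrand m a x y C u := by
  have hm := Contour.neg_one_lt_natCast m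
  have hG : (Real.Gamma ((m : ℝ) + 1) : ℂ) ≠ 0 := by
    exact_mod_cast (by simpa using (Gamma_pos_of_neg_one_lt hm 0).ne' :
      Real.Gamma ((m : ℝ) + 1) ≠ 0)
  rw [quadrupleIntegrand, doubleIntegrand, ← Contour.integral_const_mul,
    ← Contour.integral_const_mul]
  refine C.integral_congr fun v hv => ?_
  have hv0 : v ≠ 0 := fun h => h0 (h ▸ hv)
  have hinner : ∀ w ∈ Cw.support, (Cz.integral fun z =>
      Complex.exp (v - u) / (u - v) * (Complex.exp (-u / w + v / z) / (z * w)) *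
        Complex.exp (x * w - y * z) * ((u / v) ^ m * (z / w) ^ m) *
          ∏ i, (u + (a i : ℂ)) / (v + a i)) =
      (Complex.exp (v - u) / (u - v) * (u / v) ^ m * (∏ i, (u + (a i : ℂ)) / (v + a i)) *
        (Cz.integral fun z => Complex.exp (-y * z) * Complex.exp (v / z) * z ^ ((m : ℤ) - 1))) *
        (Complex.exp (x * w) * Complex.exp (-u / w) * w ^ (-(m : ℤ) - 1)) := by
    intro w hws
    have hw0 : w ≠ 0 := fun h => hw.1 (h ▸ hws)
    rw [mul_right_comm, ← Contour.integral_const_mul]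
    refine Cz.integral_congr fun z hzs => ?_
    have hz0 : z ≠ 0 := fun h => hz.1 (h ▸ hzs)
    rw [zpow_sub₀ hz0, zpow_sub₀ hw0, zpow_neg, zpow_natCast, zpow_natCast, zpow_one, zpow_one,
      Complex.exp_add, sub_eq_add_neg (x * w), Complex.exp_add, ← neg_mul, div_pow z w]
    field_simp
  rw [Cw.integral_congr hinner, Contour.integral_const_mul,
    Cw.integral_exp_mul_exp_mul_zpow_neg hw, Cz.integral_exp_mul_exp_mul_zpow_sub_one hz]
  have e1 : ((hyp0F1 ((m : ℝ) + 1) (-(x * u)) : ℝ) : ℂ) = Real.Gamma ((m : ℝ) + 1) *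
      expSeries (fun n => (invGamma m n : ℂ)) (x * -u) := by
    rw [ofReal_hyp0F1, Complex.ofReal_add, Complex.ofReal_one, hyp0F1_eq_expSeries hm]
    push_cast
    rw [mul_neg]
  rw [Complex.ofReal_mul (u ^ (m : ℝ) * Real.exp (-u)), e1, hyp0F1_eq_expSeries hm,
    sub_eq_add_neg v, Complex.exp_add, div_pow, Real.rpow_natCast, neg_mul (y : ℂ) v]
  push_cast
  field_simp

/-! ### The assembled formulas -/

/-- The real function of `u` that the double integrands agree with for all separating contours. -/
def reducedIntegrand (α : ℝ) (a : Fin N → ℝ) (x y u : ℝ) : ℂ :=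
  ((Real.Gamma (α + 1) ^ 2 / (y ^ α * Real.exp (-y)) *
    ∑ i, kernelCoeff α a y i * ((-u) ^ (i : ℕ) * weight α (-x) u) : ℝ) : ℂ)

theorem integrableOn_reducedIntegrand {α : ℝ} (hα : -1 < α) (a : Fin N → ℝ) (x y : ℝ) :
    IntegrableOn (reducedIntegrand α a x y) (Ioi 0) :=
  ((integrableOn_sum_kernelCoeff hα a x y).1.const_mul _).ofReal

theorem kernel_eq_integral_reducedIntegrand {α : ℝ} (hα : -1 < α) (a : Fin N → ℝ) (x : ℝ)
    {y : ℝ} (hy : 0 < y) :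
    ((y ^ α * Real.exp (-y + x) / Real.Gamma (α + 1) ^ 2 : ℝ) : ℂ) *
      ∫ u in Ioi (0 : ℝ), reducedIntegrand α a x y u = (kernel α a x y : ℂ) := by
  have h0 : Real.Gamma (α + 1) ≠ 0 := by simpa using (Gamma_pos_of_neg_one_lt hα 0).ne'
  have hyα := (Real.rpow_pos_of_pos hy α).ne'
  have hex := (Real.exp_pos x).ne'
  have hey := (Real.exp_pos y).ne'
  unfold reducedIntegrand
  rw [integral_complex_ofReal, integral_const_mul, (integrableOn_sum_kernelCoeff hα a x y).2,
    ← Complex.ofReal_mul, Complex.ofReal_inj, Real.exp_add, Real.exp_neg, Real.exp_neg]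
  field_simp

/-- Dominated convergence with majorant `‖f‖` on `Ioi 0`; at each `u` the indicator of `Ioi ε` is
eventually constant. -/
theorem tendsto_setIntegral_Ioi_nhdsGT_zero {f : ℝ → ℂ} (hf : IntegrableOn f (Ioi 0)) :
    Tendsto (fun ε : ℝ => ∫ u in Ioi ε, f u) (𝓝[>] 0) (𝓝 (∫ u in Ioi 0, f u)) := by
  rw [← integrable_indicator_iff measurableSet_Ioi] at hf
  simp only [← integral_indicator measurableSet_Ioi]
  refine tendsto_integral_filter_of_dominated_convergence
    (fun u => ‖(Ioi (0 : ℝ)).indicator f u‖) ?_ ?_ hf.norm (ae_of_all _ fun u => ?_)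
  · filter_upwards [self_mem_nhdsWithin] with ε hε
    have h : (Ioi ε).indicator f = (Ioi ε).indicator ((Ioi (0 : ℝ)).indicator f) := by
      rw [indicator_indicator, inter_eq_left.2 (Ioi_subset_Ioi (le_of_lt hε))]
    rw [h]
    exact hf.1.indicator measurableSet_Ioi
  · filter_upwards [self_mem_nhdsWithin] with ε hε
    exact ae_of_all _ fun u => norm_indicator_le_of_subset (Ioi_subset_Ioi (le_of_lt hε)) f u
  · rcases le_or_gt u 0 with hu | hu
    · refine tendsto_const_nhds.congr' ?_
      filter_upwards [self_mem_nhdsWithin] with ε hε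
      have hε' : (0 : ℝ) < ε := hε
      rw [indicator_of_notMem (by simpa using hu), indicator_of_notMem (by simpa using by linarith)]
    · refine tendsto_const_nhds.congr' ?_
      filter_upwards [Ioo_mem_nhdsGT hu] with ε hε
      rw [indicator_of_mem (show u ∈ Ioi (0 : ℝ) from hu),
        indicator_of_mem (show u ∈ Ioi ε from hε.2)]

/-- At `b = 0` the series in the two weights is the same nonzero constant, so their ratio is `x^m
e^{-x} / (y^m e^{-y})`. -/
theorem weight_ratio_mul_kernel (m : ℕ) {N : ℕ} (a : Fin N → ℝ) (x : ℝ) {y : ℝ} (hy : 0 < y) :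
    ((x ^ m / Real.Gamma ((m : ℝ) + 1) ^ 2 : ℝ) : ℂ) *
      ∫ u in Ioi (0 : ℝ), reducedIntegrand m a x y u =
        ((weight m 0 x / weight m 0 y * kernel m a x y : ℝ) : ℂ) := by
  have hm := Contour.neg_one_lt_natCast m
  have hE : expSeries (fun n => (invGamma m n : ℂ)) 0 ≠ 0 := by
    rw [expSeries, tsum_eq_single 0 fun n hn => by simp [hn]]
    simpa [Contour.invGamma_natCast] using Nat.factorial_ne_zero m
  have hG : (Real.Gamma ((m : ℝ) + 1) : ℂ) ≠ 0 := by
    exact_mod_cast (by simpa using (Gamma_pos_of_neg_one_lt hm 0).ne' :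
      Real.Gamma ((m : ℝ) + 1) ≠ 0)
  have hy0 : (y : ℂ) ≠ 0 := by exact_mod_cast hy.ne'
  have hexp := Complex.exp_ne_zero
  rw [Complex.ofReal_mul (_ / _) (kernel m a x y), Complex.ofReal_div (weight m 0 x),
    ofReal_weight hm, ofReal_weight hm,
    ← kernel_eq_integral_reducedIntegrand hm a x hy, ← mul_assoc]
  congr 1
  simp only [Real.rpow_natCast, Complex.ofReal_zero, zero_mul]
  push_cast
  rw [Complex.exp_add, Complex.exp_neg, Complex.exp_neg]
  field_simp [hexp x, hexp y]

end PerturbedChGUE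

end

open PerturbedChGUE
theorem proposition4 (N : ℕ) (α : ℝ) (hα : -1 < α) (a : Fin N → ℝ) (ha : ∀ i, 0 ≤ a i) :
    -- the kernel is well defined
    (∀ i j : Fin N, IntegrableOn (fun x => eta α i x * xi α a j x) (Ioi 0)) ∧
    IsUnit (gram (Ioi 0) (eta α) (xi α a)).det ∧
    -- positive parameters
    ((∀ i, 0 < a i) → ∀ x y : ℝ, 0 < x → 0 < y → ∀ C : ℝ → Contour,
      (∀ u, 0 < u → (C u).Separates a u) →
      (IntegrableOn (fun u => doubleIntegrand α a x y (C u) u) (Ioi 0) ∧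
        (kernel α a x y : ℂ) =
          ((y ^ α * Real.exp (-y + x) / Real.Gamma (α + 1) ^ 2 : ℝ) : ℂ) *
            ∫ u in Ioi 0, doubleIntegrand α a x y (C u) u) ∧
      ∀ m : ℕ, α = m → ∀ Cw Cz : Contour, Cw.Encircles 0 → Cz.Encircles 0 →
        (∀ u, 0 < u → (0 : ℂ) ∉ (C u).support) →
        IntegrableOn (fun u => quadrupleIntegrand m a x y Cw Cz (C u) u) (Ioi 0) ∧
        ((weight α 0 x / weight α 0 y * kernel α a x y : ℝ) : ℂ) =
          ∫ u in Ioi 0, quadrupleIntegrand m a x y Cw Cz (C u) u) ∧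
    -- nonnegative parameters, some of which may vanish; the contour may depend on `ε` and `u`
    (∀ x y : ℝ, 0 < x → 0 < y → ∀ C : ℝ → ℝ → Contour,
      (∀ ε u, 0 < ε → ε < u → (C ε u).Separates a u) →
      ((∀ ε, 0 < ε → IntegrableOn (fun u => doubleIntegrand α a x y (C ε u) u) (Ioi ε)) ∧
        Tendsto (fun ε : ℝ =>
            ((y ^ α * Real.exp (-y + x) / Real.Gamma (α + 1) ^ 2 : ℝ) : ℂ) *
              ∫ u in Ioi ε, doubleIntegrand α a x y (C ε u) u)
          (𝓝[>] 0) (𝓝 (kernel α a x y : ℂ))) ∧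
      ∀ m : ℕ, α = m → ∀ Cw Cz : Contour, Cw.Encircles 0 → Cz.Encircles 0 →
        (∀ ε u, 0 < ε → ε < u → (0 : ℂ) ∉ (C ε u).support) →
        (∀ ε, 0 < ε →
          IntegrableOn (fun u => quadrupleIntegrand m a x y Cw Cz (C ε u) u) (Ioi ε)) ∧
        Tendsto (fun ε : ℝ => ∫ u in Ioi ε, quadrupleIntegrand m a x y Cw Cz (C ε u) u)
          (𝓝[>] 0) (𝓝 ((weight α 0 x / weight α 0 y * kernel α a x y : ℝ) : ℂ))) := by
  refine ⟨integrableOn_xi hα a, isUnit_det_gram hα a, ?_, ?_⟩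
  · intro _ x y _ hy C hC
    have hd : EqOn (reducedIntegrand α a x y) (fun u => doubleIntegrand α a x y (C u) u) (Ioi 0) :=
      fun u hu => (doubleIntegrand_eq hα a x hy (hC u hu)).symm
    refine ⟨⟨(integrableOn_reducedIntegrand hα a x y).congr_fun hd measurableSet_Ioi, ?_⟩, ?_⟩
    · rw [← setIntegral_congr_fun measurableSet_Ioi hd,
        kernel_eq_integral_reducedIntegrand hα a x hy]
    · rintro m rfl Cw Cz hw hz h0
      have hq : EqOn (fun u => ((x ^ m / Real.Gamma ((m : ℝ) + 1) ^ 2 : ℝ) : ℂ) *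
          reducedIntegrand m a x y u) (fun u => quadrupleIntegrand m a x y Cw Cz (C u) u) (Ioi 0) :=
        fun u hu => by
          simp only [quadrupleIntegrand_eq m a x y hw hz (h0 u hu)]
          rw [hd hu]
      refine ⟨IntegrableOn.congr_fun ((integrableOn_reducedIntegrand hα a x y).const_mul _) hq
        measurableSet_Ioi, ?_⟩
      rw [← setIntegral_congr_fun measurableSet_Ioi hq, integral_const_mul,
        weight_ratio_mul_kernel m a x hy]
  · intro x y _ hy C hC
    -- All truncated integrals, whatever the contours for each `ε`, are integrals of the same
    -- function over `Ioi ε`.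
    have hd : ∀ ε, 0 < ε → EqOn (reducedIntegrand α a x y)
        (fun u => doubleIntegrand α a x y (C ε u) u) (Ioi ε) := fun ε hε u hu =>
      (doubleIntegrand_eq hα a x hy (hC ε u hε hu)).symm
    have hi := integrableOn_reducedIntegrand hα a x y
    have hiε : ∀ ε, 0 < ε → IntegrableOn (reducedIntegrand α a x y) (Ioi ε) := fun ε hε =>
      hi.mono_set (Ioi_subset_Ioi hε.le)
    have hlim := tendsto_setIntegral_Ioi_nhdsGT_zero hi
    refine ⟨⟨fun ε hε => (hiε ε hε).congr_fun (hd ε hε) measurableSet_Ioi, ?_⟩, ?_⟩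
    · rw [← kernel_eq_integral_reducedIntegrand hα a x hy]
      refine (hlim.const_mul _).congr' ?_
      filter_upwards [self_mem_nhdsWithin] with ε hε
      rw [setIntegral_congr_fun measurableSet_Ioi (hd ε hε)]
    · rintro m rfl Cw Cz hw hz h0
      have hq : ∀ ε, 0 < ε → EqOn (fun u => ((x ^ m / Real.Gamma ((m : ℝ) + 1) ^ 2 : ℝ) : ℂ) *
          reducedIntegrand m a x y u) (fun u => quadrupleIntegrand m a x y Cw Cz (C ε u) u)
          (Ioi ε) := fun ε hε u hu => by
        simp only [quadrupleIntegrand_eq m a x y hw hz (h0 ε u hε hu)]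
        rw [hd ε hε hu]
      refine ⟨fun ε hε => IntegrableOn.congr_fun ((hiε ε hε).const_mul _) (hq ε hε)
        measurableSet_Ioi, ?_⟩
      rw [← weight_ratio_mul_kernel m a x hy]
      refine (hlim.const_mul _).congr' ?_
      filter_upwards [self_mem_nhdsWithin] with ε hε
      rw [← setIntegral_congr_fun measurableSet_Ioi (hq ε hε), integral_const_mul]
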